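/- **Setting.** Let $M$ be a compact orientable 3-manifold with an angled ideal triangulation: $M-\partial M$ is a finite union of 3-simplices glued along their faces in pairs, with the vertices removed; each edge of each simplex carries an interior angle in $(0,\pi)$; the three angles at each vertex of each simplex sum to $\pi$; and the angles around each edge of the triangulation sum to $2\pi$. Truncating the ideal vertices triangulates $\partial M$, one triangle for each vertex of each simplex, and each triangle inherits three angles with sum $\pi$. Let $\mathcal H$ be the handle structure on $M$ dual to the triangulation (one $i$-handle for each $(3-i)$-simplex, $i=0,1,2$), let $\mathcal H^0$ be the union of its 0-handles, and let $\mathcal F^0$ and $\mathcal F^1$ be the intersections of $\mathcal H^0$ with the 1-handles and with the 2-handles. So in the boundary sphere of the 0-handle of a simplex there is a disc of $\mathcal F^0$ for each face, a strip of $\mathcal F^1$ for each edge, joining the discs of the two faces containing it, and a disc of $\partial M$ for each vertex. The exterior angle of a strip is $\pi$ minus the interior angle of its edge. **Admissible discs.** Consider discs $H$ in a 0-handle, not necessarily embedded, such that the components of $\partial H-\partial\mathcal H^0$ have their ends in the interior of $\mathcal F^0$. Such an $H$ is admissible if $\partial H\cap\partial\mathcal H^0$ does not lie entirely in $\partial M$,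 crosses strips only from end to end, no arc of it in a vertex disc of $\partial M$ has both ends in the same component of $\partial\mathcal F^0-\mathcal F^1$, and no arc of it in $\mathcal F^0$ with both ends in $\partial\mathcal F^0$ has its ends in the same, or in adjacent, components of $\partial\mathcal F^0\cap\mathcal F^1$ and $\partial\mathcal F^0-\mathcal F^1$. If $\epsilon_1,\dots,\epsilon_k$ are the exterior angles of the strips crossed by $\partial H$, with multiplicity, its combinatorial area is $$a(H)=\sum_{j=1}^k\epsilon_j-2\pi+\pi\,|H\cap\partial M|+3\pi\,|\partial H-\partial\mathcal H^0|,$$ where $|\cdot|$ counts components. **Combinatorial length.** Let $C$ be a closed curve on $\partial M$ which is disjoint from the 2-handles and vertical in the 1-handles, and which meets the 0-handles and the 1-handles in arcs $C^0_1,C^1_1,\dots,C^0_n,C^1_n$ ($n\ge1$), in this cyclic order. An inward extension $\mathcal E$ of $C$ consists of admissible discs $H^0_i\supset C^0_i$ in 0-handles and discs $H^1_i\supset C^1_i$ in 1-handles, each $H^1_i$ being the product of an interval with an arc, such that for every $i$ (cyclically) the arcs of $H^0_i$ and $H^1_i$ in $\mathcal F^0$ touching $C^0_i\cap C^1_i$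 agree, and so do those of $H^1_i$ and $H^0_{i+1}$ touching $C^1_i\cap C^0_{i+1}$. Its weight is $w(\mathcal E)=\sum_i a(H^0_i)/|H^0_i\cap\partial M|$. Let $l(C)=\inf_{\mathcal E}w(\mathcal E)$, with $l(C)=\infty$ if there is no inward extension. For a free homotopy class $s$ of homotopically non-trivial closed curves on $\partial M$, taken up to orientation, let $l(s)$ be the infimum of $l(C)$ over all such $C$ representing a non-zero multiple of $s$. **Proposition 4.10.** Give each edge $E$ of the triangulation of $\partial M$ the length $\min\{\alpha_1,\dots,\alpha_6\}/2$, where $\alpha_1,\dots,\alpha_6$ are the angles of the two triangles adjacent to $E$, and give each closed path in the 1-skeleton of $\partial M$ (not necessarily embedded) the sum of the lengths of the edges it runs along, with multiplicity. Let $s$ be a free homotopy class of homotopically non-trivial closed curves on $\partial M$, taken up to orientation; in particular, $s$ may be any slope, i.e. the class of an essential simple closed curve. Then among the closed paths in the 1-skeleton of $\partial M$ that represent $s$ there is one of smallest length, and this smallest length is at most $l(s)$. -/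

import Mathlib

/-! Conventions.  The vertices of every tetrahedron are labelled by `Fin 4`; the face labelled `f` is
the face opposite to the vertex `f`.  Truncating the ideal vertices, each pair `(t, v)` gives one
triangle of the boundary `∂M`.  This triangle has a side `(t, v, f)` for every `f ≠ v` (its
intersection with the face `f`) and a corner `(t, v, w)` for every `w ≠ v` (its intersection with
the edge `vw`).  The corner `w` lies on the side `f` if and only if `w ≠ f`. -/

/-- Tetrahedra indexed by `T` whose faces are glued in pairs: the face `f` of `t` is glued to the face
`glue t f f` of `nbr t f`, each vertex `i ≠ f` of that face being sent to `glue t f i`. -/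
structure FaceGluing (T : Type*) where
  nbr : T → Fin 4 → T
  glue : T → Fin 4 → Equiv.Perm (Fin 4)
  nbr_nbr : ∀ t f, nbr (nbr t f) (glue t f f) = t
  glue_glue : ∀ t f, glue (nbr t f) (glue t f f) = (glue t f)⁻¹
  not_self_glued : ∀ t f, ¬ (nbr t f = t ∧ glue t f f = f)

namespace FaceGluing

variable {T : Type*} (M : FaceGluing T)

/-- Elementary identification of directed edges: `(t, i, j)` stands for the edge of `t` directed
from `i` to `j`, and a face `f` containing it identifies it with an edge of the neighbour. -/
inductive EdgeStep : T × Fin 4 × Fin 4 → T × Fin 4 × Fin 4 → Prop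
  | mk (t : T) (f i j : Fin 4) (hi : i ≠ f) (hj : j ≠ f) :
      EdgeStep (t, i, j) (M.nbr t f, M.glue t f i, M.glue t f j)

/-- Directed edges of the ideal triangulation.  The class of `(t, v, w)` is also the vertex of
`∂M` at which that edge leaves the ideal vertex `v`, i.e. the corner `(t, v, w)`. -/
def DirectedEdge : Type _ := Quot M.EdgeStep

/-- Elementary identification of sides of boundary triangles. -/
inductive SideStep : T × Fin 4 × Fin 4 → T × Fin 4 × Fin 4 → Prop
  | mk (t : T) (v f : Fin 4) (h : v ≠ f) :
      SideStep (t, v, f) (M.nbr t f, M.glue t f v, M.glue t f f)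

/-- Edges of the triangulation of `∂M`. -/
def BoundaryEdge : Type _ := Quot M.SideStep

def directedEdge (t : T) (i j : Fin 4) : M.DirectedEdge := Quot.mk _ (t, i, j)

def boundaryEdge (t : T) (v f : Fin 4) : M.BoundaryEdge := Quot.mk _ (t, v, f)

/-- Coherent orientations of all the tetrahedra: a face gluing has to reverse the orientations
that are induced on the two faces. -/
def Orientable : Prop :=
  ∃ o : T → ℤˣ, ∀ t f, o (M.nbr t f) = -(Equiv.Perm.sign (M.glue t f)) * o t

end FaceGluing

/-- An ideal triangulation: gluing tetrahedra along faces and then removing the vertices gives a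
3-manifold exactly when no edge is identified with its own reverse. -/
structure IdealTriangulation (T : Type*) extends FaceGluing T where
  no_reversed_edge : ∀ t i j, i ≠ j →
    toFaceGluing.directedEdge t i j ≠ toFaceGluing.directedEdge t j i

open Classical in
/-- Interior angles making the ideal triangulation an angled one.  In the last condition every
edge of a tetrahedron lying around the given edge is counted exactly once, with the direction
that corresponds to the direction `i → j`. -/
structure AngleStructure {T : Type*} [Fintype T] (M : IdealTriangulation T) where
  angle : T → Sym2 (Fin 4) → ℝ
  angle_mem : ∀ t i j, i ≠ j → angle t s(i, j) ∈ Set.Ioo 0 Real.pi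
  vertex_sum : ∀ t v, ∑ w ∈ Finset.univ.erase v, angle t s(v, w) = Real.pi
  edge_sum : ∀ t i j, i ≠ j →
    ∑ x ∈ Finset.univ.filter (fun x : T × Fin 4 × Fin 4 =>
      M.directedEdge x.1 x.2.1 x.2.2 = M.directedEdge t i j),
        angle x.1 s(x.2.1, x.2.2) = 2 * Real.pi

/-! ### Curves on the boundary and free homotopy

Join the centre of every boundary triangle to the midpoints of its three sides.  Together with the
1-skeleton of the triangulation, subdivided at the midpoints of edges, this cuts `∂M` into
quadrilaterals, one for each corner of each triangle.  Closed curves are closed edge paths in this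
cell structure, which contains the 1-skeleton of the triangulation and its dual graph. -/

namespace FaceGluing

variable {T : Type*} (M : FaceGluing T)

/-- Vertices of the cell structure on `∂M`. -/
inductive Node
  | centre (t : T) (v : Fin 4)
  | mid (e : M.BoundaryEdge)
  | vertex (p : M.DirectedEdge)

/-- Directed 1-cells: `spoke t v f` runs from the centre of the triangle `(t, v)` to the midpoint
of its side `f`, and `half t v f w` runs along the side `f` from its end `w` to its midpoint. -/
inductive Arc (T : Type*)
  | spoke (t : T) (v f : Fin 4) (h : v ≠ f)
  | half (t : T) (v f w : Fin 4) (h : [v, f, w].Nodup)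

/-- A letter `(a, true)` traverses the 1-cell `a` forwards, and `(a, false)` backwards. -/
abbrev Word (T : Type*) := List (Arc T × Bool)

def arcSrc : Arc T → M.Node
  | .spoke t v _ _ => .centre t v
  | .half t v _ w _ => .vertex (M.directedEdge t v w)

def arcTgt : Arc T → M.Node
  | .spoke t v f _ => .mid (M.boundaryEdge t v f)
  | .half t v f _ _ => .mid (M.boundaryEdge t v f)

def src (a : Arc T × Bool) : M.Node := if a.2 then M.arcSrc a.1 else M.arcTgt a.1

def tgt (a : Arc T × Bool) : M.Node := if a.2 then M.arcTgt a.1 else M.arcSrc a.1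

/-- Each letter ends where the cyclically next one starts. -/
def IsClosedWalk (w : Word T) : Prop :=
  (w ++ w.head?.toList).IsChain (fun a b => M.tgt a = M.src b)

/-- Boundary words of 2-cells: the quadrilateral of each corner `w` of the triangle `(t, v)`, lying
between the sides `f` and `g`; and a degenerate bigon for each half-side, expressing that it is
identified with a half-side of the neighbouring triangle. -/
inductive IsCell : Word T → Prop
  | quad (t : T) (v f g w : Fin 4) (hf : v ≠ f) (hg : v ≠ g) (hfw : [v, f, w].Nodup)
      (hgw : [v, g, w].Nodup) (hfg : f ≠ g) :
      IsCell [(.spoke t v f hf, true), (.half t v f w hfw, false),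
        (.half t v g w hgw, true), (.spoke t v g hg, false)]
  | bigon (t : T) (v f w : Fin 4) (h : [v, f, w].Nodup)
      (h' : [M.glue t f v, M.glue t f f, M.glue t f w].Nodup) :
      IsCell [(.half t v f w h, true),
        (.half (M.nbr t f) (M.glue t f v) (M.glue t f f) (M.glue t f w) h', false)]

/-- Combinatorial free homotopy of closed edge paths in `∂M` (the empty word stands for a
constant path): change of starting point, removal of a backtracking, and removal of the
boundary of a 2-cell generate the relation. -/
inductive FreelyHomotopic : Word T → Word T → Prop
  | refl (w) : FreelyHomotopic w w
  | symm {u w} : FreelyHomotopic u w → FreelyHomotopic w u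
  | trans {u w x} : FreelyHomotopic u w → FreelyHomotopic w x → FreelyHomotopic u x
  | rotate (u w) : M.IsClosedWalk (u ++ w) → FreelyHomotopic (u ++ w) (w ++ u)
  | cancel (a b w) : M.IsClosedWalk ((a, b) :: (a, !b) :: w) →
      FreelyHomotopic ((a, b) :: (a, !b) :: w) w
  | cell (r w) : M.IsCell r → M.IsClosedWalk (r ++ w) → FreelyHomotopic (r ++ w) w

/-- Closed curves on `∂M`. -/
structure ClosedCurve where
  word : Word T
  closed : M.IsClosedWalk word

/-- The closed curve `s` is not homotopically trivial in `∂M`. -/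
def ClosedCurve.Essential {M : FaceGluing T} (s : M.ClosedCurve) : Prop :=
  ¬ M.FreelyHomotopic s.word []

/-- The reversed path. -/
def Word.reverse (w : Word T) : Word T := (w.map fun a => (a.1, !a.2)).reverse

/-- The path traversed `k` times. -/
def Word.power (w : Word T) (k : ℕ) : Word T := (List.replicate k w).flatten

/-- `w` represents the free homotopy class of `s`, up to orientation. -/
def HasClass (w : Word T) (s : M.ClosedCurve) : Prop :=
  M.FreelyHomotopic w s.word ∨ M.FreelyHomotopic w (Word.reverse s.word)

/-- `w` represents a non-zero (positive or negative) multiple of `s`. -/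
def HasMultipleClass (w : Word T) (s : M.ClosedCurve) : Prop :=
  ∃ k : ℕ, 0 < k ∧ (M.FreelyHomotopic w (Word.power s.word k) ∨
    M.FreelyHomotopic w (Word.power (Word.reverse s.word) k))

/-- The side `f` of the boundary triangle `(t, v)`, directed from the corner `a` to the corner `b`. -/
structure DirectedSide (T : Type*) where
  t : T
  v : Fin 4
  f : Fin 4
  a : Fin 4
  b : Fin 4
  distinct_a : [v, f, a].Nodup
  distinct_b : [v, f, b].Nodup
  a_ne_b : a ≠ b

/-- The directed side as a path in the cell structure. -/
def DirectedSide.path (d : DirectedSide T) : Word T :=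
  [(.half d.t d.v d.f d.a d.distinct_a, true), (.half d.t d.v d.f d.b d.distinct_b, false)]

/-- Closed paths, not necessarily embedded, in the 1-skeleton of the triangulation of `∂M`. -/
structure SimplicialCurve where
  sides : List (DirectedSide T)
  closed : M.IsClosedWalk (sides.flatMap DirectedSide.path)

def SimplicialCurve.word {M : FaceGluing T} (γ : M.SimplicialCurve) : Word T :=
  γ.sides.flatMap DirectedSide.path

/-- Closed curves `C` on `∂M` respecting the dual handle structure, i.e. disjoint from its 2-handles
(neighbourhoods of vertices) and vertical in its 1-handles (neighbourhoods of edges), and meeting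
at least one 1-handle.  The arc `i` of `C` in the 0-handles lies in the triangle `(t i, v i)`, which
it enters through the side `f i` and leaves through the side `g i`.  The indices are cyclic. -/
structure HandleCurve (n : ℕ) [NeZero n] where
  t : Fin n → T
  v : Fin n → Fin 4
  f : Fin n → Fin 4
  g : Fin n → Fin 4
  v_ne_f : ∀ i, v i ≠ f i
  v_ne_g : ∀ i, v i ≠ g i
  t_succ : ∀ i, t (i + 1) = M.nbr (t i) (g i)
  v_succ : ∀ i, v (i + 1) = M.glue (t i) (g i) (v i)
  f_succ : ∀ i, f (i + 1) = M.glue (t i) (g i) (g i)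

/-- The path through the centres of triangles and the midpoints of sides that `C` follows. -/
def HandleCurve.word {M : FaceGluing T} {n : ℕ} [NeZero n] (C : M.HandleCurve n) : Word T :=
  (List.finRange n).flatMap fun i =>
    [(.spoke (C.t i) (C.v i) (C.g i) (C.v_ne_g i), true),
      (.spoke (C.t (i + 1)) (C.v (i + 1)) (C.f (i + 1)) (C.v_ne_f (i + 1)), false)]

end FaceGluing

/-! ### Discs in the 0-handles

The 0-handle of the tetrahedron `t` is a ball.  Its boundary sphere is made up of a disc of `𝓕⁰`
for each face, a strip of `𝓕¹` for each edge `ab`, joining the discs of the two faces containing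
`ab`, and a disc of `∂M` for each vertex.  The disc of a face is a hexagon whose sides
alternately lie on the strips of its edges and on the discs of its vertices.  Up to isotopy
preserving this structure, the boundary of a disc `H` in the 0-handle is recorded by the cyclic
sequence of its components outside `𝓕⁰`; consecutive ones are joined by an arc in `𝓕⁰`. -/

/-- Where an arc in the `𝓕⁰`-disc of a face may end: on the strip of an edge, on the `∂M`-disc of a
vertex, or in the interior of the `𝓕⁰`-disc (at an end of a component of `∂H - ∂𝓗⁰`). -/
inductive FaceSide
  | edge (e : Sym2 (Fin 4))
  | vertex (v : Fin 4)
  | interior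

/-- The arcs of `𝓕⁰` allowed in admissible curves: the ends do not lie in the same side nor in adjacent
sides of the hexagon.  No condition is imposed if an end is interior. -/
def FaceSide.Admissible : FaceSide → FaceSide → Prop
  | .edge e, .edge e' => e ≠ e'
  | .vertex v, .vertex w => v ≠ w
  | .edge e, .vertex v => v ∉ e
  | .vertex v, .edge e => v ∉ e
  | .interior, _ => True
  | _, .interior => True

def FaceSide.map (σ : Equiv.Perm (Fin 4)) : FaceSide → FaceSide
  | .edge e => .edge (e.map σ)
  | .vertex v => .vertex (σ v)
  | .interior => .interior

/-- Components outside `𝓕⁰` of the boundary of a disc `H` in a 0-handle, running from the face `f` to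
the face `g`: along the strip of the edge `ab`; in the `∂M`-disc of the vertex `v`; or in
the interior of the 0-handle, as a component of `∂H - ∂𝓗⁰`. -/
inductive Segment
  | strip (a b f g : Fin 4)
  | cusp (v f g : Fin 4)
  | gap (f g : Fin 4)

namespace Segment

/-- A strip joins the two faces containing its edge; an arc in the `∂M`-disc of a vertex has ends
in different faces containing that vertex. -/
def Valid : Segment → Prop
  | strip a b f g => [a, b, f, g].Nodup
  | cusp v f g => [v, f, g].Nodup
  | gap _ _ => True

def srcFace : Segment → Fin 4
  | strip _ _ f _ => f
  | cusp _ f _ => f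
  | gap f _ => f

def tgtFace : Segment → Fin 4
  | strip _ _ _ g => g
  | cusp _ _ g => g
  | gap _ g => g

/-- Both ends of a segment lie on the same kind of side, in its two faces. -/
def side : Segment → FaceSide
  | strip a b _ _ => .edge s(a, b)
  | cusp v _ _ => .vertex v
  | gap _ _ => .interior

/-- `x` may be followed by `y` in the boundary of a disc with admissible `H ∩ ∂𝓗⁰`. -/
def Linked (x y : Segment) : Prop :=
  x.tgtFace = y.srcFace ∧ FaceSide.Admissible x.side y.side

/-- Contribution of a segment to combinatorial area (`θ` gives the interior angles). -/
noncomputable def cost (θ : Sym2 (Fin 4) → ℝ) : Segment → ℝ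
  | strip a b _ _ => Real.pi - θ s(a, b)
  | cusp _ _ _ => Real.pi
  | gap _ _ => 3 * Real.pi

/-- The combinatorial area `a(H)`: the sum of the exterior angles along `∂H`, minus `2π`, plus
`π |H ∩ ∂M|`, plus `3π |∂H - ∂𝓗⁰|`. -/
noncomputable def area (θ : Sym2 (Fin 4) → ℝ) (H : List Segment) : ℝ :=
  (H.map (cost θ)).sum - 2 * Real.pi

def isCusp : Segment → Bool
  | cusp _ _ _ => true
  | _ => false

/-- The number `|H ∩ ∂M|` of arcs. -/
def cuspCount (H : List Segment) : ℕ := H.countP isCusp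

end Segment

namespace FaceGluing.HandleCurve

variable {T : Type*} {M : FaceGluing T} {n : ℕ} [NeZero n] (C : M.HandleCurve n)

/-- The arc `i` of `C` in the 0-handles of `∂M`. -/
def arc (i : Fin n) : Segment := .cusp (C.v i) (C.f i) (C.g i)

/-- Inward extensions of `C`.  The boundary of the disc `i` in the 0-handle of `t i` consists of the
arc `i` of `C` followed by `rest i`.  The disc `i` in the 1-handles is the product of an interval
with an arc starting at `C` in the face disc `g i` of `t i`; that arc has to be the one following
the arc `i` of `C` in the disc `i`, and also the one preceding the arc `i + 1` of `C` in the
disc `i + 1`. -/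
structure InwardExtension where
  rest : Fin n → List Segment
  valid : ∀ i, ∀ x ∈ C.arc i :: rest i, x.Valid
  admissible : ∀ i, (C.arc i :: (rest i ++ [C.arc i])).IsChain Segment.Linked
  agree : ∀ i, (rest i).head?.map (fun x => x.side.map (M.glue (C.t i) (C.g i))) =
    (rest (i + 1)).getLast?.map Segment.side

/-- The boundary of the disc `i` in the 0-handles. -/
def InwardExtension.disc {C : M.HandleCurve n} (E : C.InwardExtension) (i : Fin n) : List Segment :=
  C.arc i :: E.rest i

end FaceGluing.HandleCurve

namespace AngleStructure

variable {T : Type*} [Fintype T] {M : IdealTriangulation T} (θ : AngleStructure M)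

/-- The smallest of the three angles of the boundary triangle `(t, v)`. -/
noncomputable def minAngle (t : T) (v : Fin 4) : ℝ :=
  min (θ.angle t s(v, v + 1)) (min (θ.angle t s(v, v + 2)) (θ.angle t s(v, v + 3)))

/-- The length of the edge of `∂M` given by the side `f` of the triangle `(t, v)`: half of the smallest
of the six angles of the two triangles adjacent to it. -/
noncomputable def edgeLength (t : T) (v f : Fin 4) : ℝ :=
  min (θ.minAngle t v) (θ.minAngle (M.nbr t f) (M.glue t f v)) / 2

/-- The length of a simplicial curve. -/
noncomputable def length (γ : M.SimplicialCurve) : ℝ :=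
  (γ.sides.map fun d => θ.edgeLength d.t d.v d.f).sum

/-- The weight of an inward extension. -/
noncomputable def weight {n : ℕ} [NeZero n] {C : M.HandleCurve n} (E : C.InwardExtension) : ℝ :=
  ∑ i, Segment.area (θ.angle (C.t i)) (E.disc i) / Segment.cuspCount (E.disc i)

/-- The combinatorial length `l(C)`; it is infinite if there is no inward extension. -/
noncomputable def curveLength {n : ℕ} [NeZero n] (C : M.HandleCurve n) : EReal :=
  ⨅ E : C.InwardExtension, (θ.weight E : EReal)

/-- The combinatorial length `l(s)`. -/
noncomputable def combinatorialLength (s : M.ClosedCurve) : EReal :=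
  ⨅ (n : ℕ) (_ : NeZero n) (C : M.HandleCurve n) (_ : M.HasMultipleClass C.word s),
    θ.curveLength C

end AngleStructure

/-! The boundary `∂M` is handled as an abstract oriented triangulated surface (`OrientedTriangulation`,
`boundarySurface`).  Two facts about it carry the proof.

**Multiples are not shorter.**  Let `s` be an essential closed curve on an oriented triangulated surface
whose edges have positive lengths, and pass to the annular covering, whose fundamental group is generated by
`s`.  If a closed path `z` there is homotopic to the `k`-th power of the lift `c` of `s`, with `k > 0`, then
`z = k c + ∂a` for a finitely supported integral 2-chain `a`.  For `0 ≤ j < k` the cycles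
`c + ∂⌊(a + j) / k⌋` are all homologous to `c`, and Hermite's identity shows that, edge by edge, the
sum of their multiplicities is at most that of `z`.  Hence one of them is at most `1 / k` times as long
as `z`; being a union of closed paths, it contains a closed path in a non-trivial multiple of `s`
(`exists_closed_mul_length_le`).  Applied to an empty path `z`, this shows that `s` has infinite
order (`hol_pow_ne_one`).  The lengths of closed paths form a well-ordered set, so some path is shortest
among those in all non-trivial multiples of `s`; if it is in the multiple `k s`, then it is at
least `|k|` times as long as itself, so that `k = ±1` (`exists_shortest_closed`).  Consequently the
shortest closed path in the class of `s` is also no longer than any closed path in a multiple of `s`.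

**Area bounds length.**  By the angle conditions, an admissible disc has area zero if it is the disc that
runs around an edge of its tetrahedron and meets `∂M` at both ends; otherwise, its area per arc in `∂M` is at
least the smallest angle of every boundary triangle it meets (`minAngle_le_area_div`).  A handle curve
is homotopic to the path in the 1-skeleton that visits, for every arc, the corner of its triangle
between the two sides that the arc crosses.  Two consecutive corners are ends of the side between their
triangles.  They agree if both discs have area zero, and otherwise the length of that edge is at most half
of one of the two areas per arc.  So an inward extension weighs at least as much as this path
(`exists_walk_le_weight`).

Paths of the given cell structure and simplicial paths are compared by the maps `realize` and `proj`.
Free homotopies are turned into conjugations in the fundamental group by `FreelyHomotopic.isConj`, and back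
by `freelyHomotopic_realize` and `freelyHomotopic_realize_proj`. -/

/-! ### Oriented triangulated surfaces and homotopy of edge paths -/

/-- An oriented triangulated surface, encoded by its directed edges ("darts").  A dart stands for the
directed edge together with the triangle on its left: `rev` reverses the direction, passing to the
triangle on the other side, and `next` goes to the following side of the triangle on the left. -/
structure OrientedTriangulation (D V : Type*) where
  src : D → V
  rev : D → D
  next : D → D
  rev_rev : ∀ d, rev (rev d) = d
  rev_ne : ∀ d, rev d ≠ d
  next_next_next : ∀ d, next (next (next d)) = d
  next_ne : ∀ d, next d ≠ d
  src_next : ∀ d, src (next d) = src (rev d)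

namespace OrientedTriangulation

variable {D V : Type*} (K : OrientedTriangulation D V)

/-- The end of a dart. -/
def tgt (d : D) : V := K.src (K.rev d)

@[simp] lemma tgt_rev (d : D) : K.tgt (K.rev d) = K.src d := by simp [tgt, K.rev_rev]

lemma src_rev (d : D) : K.src (K.rev d) = K.tgt d := rfl

lemma src_next' (d : D) : K.src (K.next d) = K.tgt d := K.src_next d

lemma tgt_next_next (d : D) : K.tgt (K.next (K.next d)) = K.src d := by
  rw [← K.src_next', K.next_next_next]

/-- `l` is an edge path from `x` to `y`. -/
def IsWalk : V → V → List D → Prop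
  | x, y, [] => x = y
  | x, y, d :: l => K.src d = x ∧ IsWalk (K.tgt d) y l

/-- The reversed edge path. -/
def inv (l : List D) : List D := (l.map K.rev).reverse

variable {K} {x y z : V} {l l' m m' : List D}

@[simp] lemma isWalk_nil : K.IsWalk x y [] ↔ x = y := Iff.rfl

@[simp] lemma isWalk_cons {d : D} :
    K.IsWalk x y (d :: l) ↔ K.src d = x ∧ K.IsWalk (K.tgt d) y l := Iff.rfl

lemma isWalk_append : K.IsWalk x y (l ++ m) ↔ ∃ z, K.IsWalk x z l ∧ K.IsWalk z y m := by
  induction l generalizing x with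
  | nil => simp
  | cons d l ih => simp [ih, and_assoc]

lemma IsWalk.append (h : K.IsWalk x y l) (h' : K.IsWalk y z m) : K.IsWalk x z (l ++ m) :=
  isWalk_append.2 ⟨y, h, h'⟩

@[simp] lemma inv_nil : K.inv [] = [] := rfl

@[simp] lemma inv_cons (d : D) : K.inv (d :: l) = K.inv l ++ [K.rev d] := by simp [inv]

@[simp] lemma inv_append : K.inv (l ++ m) = K.inv m ++ K.inv l := by simp [inv]

@[simp] lemma inv_inv : K.inv (K.inv l) = l := by
  induction l with
  | nil => rfl
  | cons d l ih => simp [ih, K.rev_rev]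

lemma IsWalk.inv (h : K.IsWalk x y l) : K.IsWalk y x (K.inv l) := by
  induction l generalizing x with
  | nil => exact Eq.symm h
  | cons d l ih =>
    rw [inv_cons]
    exact (ih h.2).append ⟨rfl, by simpa using h.1⟩

/-- Homotopy of edge paths from `x` to `y` with fixed ends, generated by the removal of spurs and of
boundaries of triangles. -/
inductive Homotopic (K : OrientedTriangulation D V) (x y : V) : List D → List D → Prop
  | refl {u : List D} : K.IsWalk x y u → Homotopic K x y u u
  | symm {u w : List D} : Homotopic K x y u w → Homotopic K x y w u
  | trans {u w p : List D} : Homotopic K x y u w → Homotopic K x y w p → Homotopic K x y u p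
  | spur {u w : List D} (d : D) : K.IsWalk x (K.src d) u → K.IsWalk (K.src d) y w →
      Homotopic K x y (u ++ d :: K.rev d :: w) (u ++ w)
  | face {u w : List D} (d : D) : K.IsWalk x (K.src d) u → K.IsWalk (K.src d) y w →
      Homotopic K x y (u ++ d :: K.next d :: K.next (K.next d) :: w) (u ++ w)

namespace Homotopic

lemma isWalk (h : K.Homotopic x y l m) : K.IsWalk x y l ∧ K.IsWalk x y m := by
  induction h with
  | refl h => exact ⟨h, h⟩
  | symm _ ih => exact ih.symm
  | trans _ _ ih ih' => exact ⟨ih.1, ih'.2⟩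
  | spur d hu hw =>
    exact ⟨hu.append ⟨rfl, K.src_rev d, by simpa using hw⟩, hu.append hw⟩
  | face d hu hw =>
    refine ⟨hu.append ⟨rfl, K.src_next' d, K.src_next' _, ?_⟩, hu.append hw⟩
    rwa [tgt_next_next]

lemma append_left (hp : K.IsWalk z x m) (h : K.Homotopic x y l l') :
    K.Homotopic z y (m ++ l) (m ++ l') := by
  induction h with
  | refl h => exact .refl (hp.append h)
  | symm _ ih => exact ih.symm
  | trans _ _ ih ih' => exact ih.trans ih'
  | spur d hu hw => simpa using spur d (hp.append hu) hw
  | face d hu hw => simpa using face d (hp.append hu) hw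

lemma append_right (h : K.Homotopic x y l l') (hp : K.IsWalk y z m) :
    K.Homotopic x z (l ++ m) (l' ++ m) := by
  induction h with
  | refl h => exact .refl (h.append hp)
  | symm _ ih => exact ih.symm
  | trans _ _ ih ih' => exact ih.trans ih'
  | spur d hu hw => simpa using spur d hu (hw.append hp)
  | face d hu hw => simpa using face d hu (hw.append hp)

lemma append (h : K.Homotopic x y l l') (h' : K.Homotopic y z m m') :
    K.Homotopic x z (l ++ m) (l' ++ m') :=
  (h.append_right h'.isWalk.1).trans (h'.append_left h.isWalk.2)

lemma append_inv (h : K.IsWalk x y l) : K.Homotopic x x (l ++ K.inv l) [] := by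
  induction l generalizing x with
  | nil => exact .refl rfl
  | cons d l ih =>
    have hd : K.IsWalk x (K.tgt d) [d] := ⟨h.1, rfl⟩
    have := ((ih h.2).append_left hd).append_right hd.inv
    have h2 := spur d (u := []) (w := []) (x := x) (y := x) h.1.symm h.1
    simpa using this.trans (by simpa using h2)

lemma inv_append (h : K.IsWalk x y l) : K.Homotopic y y (K.inv l ++ l) [] := by
  simpa using append_inv h.inv

lemma inv (h : K.Homotopic x y l m) : K.Homotopic y x (K.inv l) (K.inv m) := by
  have h1 := (append_inv h.isWalk.2).symm.append_left h.isWalk.1.inv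
  have h2 := (h.symm.append_left h.isWalk.1.inv).append_right h.isWalk.2.inv
  have h3 := (inv_append h.isWalk.1).append_right h.isWalk.2.inv
  simpa using (h1.trans (by simpa using h2)).trans h3

end Homotopic

/-! ### The fundamental group and its holonomy -/

/-- A map from darts to a group that respects the relations coming from reversal and from triangles.
It assigns an element of the group to every list of darts, invariantly under homotopy. -/
structure Holonomy (K : OrientedTriangulation D V) (G : Type*) [Group G] where
  val : D → G
  val_rev : ∀ d, val (K.rev d) = (val d)⁻¹
  val_next : ∀ d, val d * val (K.next d) * val (K.next (K.next d)) = 1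

namespace Holonomy

variable {G : Type*} [Group G] (ω : K.Holonomy G)

/-- The product of the values along a list of darts. -/
def hol (l : List D) : G := (l.map ω.val).prod

@[simp] lemma hol_nil : ω.hol [] = 1 := rfl

@[simp] lemma hol_cons (d : D) : ω.hol (d :: l) = ω.val d * ω.hol l := by simp [hol]

@[simp] lemma hol_append : ω.hol (l ++ m) = ω.hol l * ω.hol m := by simp [hol]

@[simp] lemma hol_inv : ω.hol (K.inv l) = (ω.hol l)⁻¹ := by
  induction l with
  | nil => simp
  | cons d l ih => simp [ih, ω.val_rev]

lemma hol_eq (h : K.Homotopic x y l m) : ω.hol l = ω.hol m := by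
  induction h with
  | refl _ => rfl
  | symm _ ih => exact ih.symm
  | trans _ _ ih ih' => exact ih.trans ih'
  | spur d _ _ => simp [ω.val_rev]
  | face d _ _ =>
    simp only [hol_append, hol_cons, ← mul_assoc]
    rw [mul_assoc (ω.hol _), mul_assoc (ω.hol _), ω.val_next, mul_one]

end Holonomy

variable (K) in
/-- Homotopy as a relation on the closed edge paths based at `v`. -/
def loopSetoid (v : V) : Setoid {l : List D // K.IsWalk v v l} where
  r a b := K.Homotopic v v a.1 b.1
  iseqv := ⟨fun a => .refl a.2, fun h => h.symm, fun h h' => h.trans h'⟩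

variable (K) in
/-- The fundamental group, based at `v`. -/
def LoopGroup (v : V) : Type _ := Quotient (K.loopSetoid v)

namespace LoopGroup

variable {v : V}

/-- The class of a closed edge path. -/
def mk (l : List D) (h : K.IsWalk v v l) : K.LoopGroup v :=
  Quotient.mk (K.loopSetoid v) ⟨l, h⟩

lemma mk_eq_mk (h : K.IsWalk v v l) (h' : K.IsWalk v v m) :
    mk l h = mk m h' ↔ K.Homotopic v v l m := by
  exact Quotient.eq

lemma exists_mk (g : K.LoopGroup v) : ∃ l h, g = mk (K := K) l h := by
  induction g using Quotient.inductionOn with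
  | h a => exact ⟨a.1, a.2, rfl⟩

instance : Mul (K.LoopGroup v) where
  mul := Quotient.map₂ (fun a b => ⟨a.1 ++ b.1, a.2.append b.2⟩)
    (fun _ _ h _ _ h' => Homotopic.append h h')

instance : Inv (K.LoopGroup v) where
  inv := Quotient.map (fun a => ⟨K.inv a.1, a.2.inv⟩) (fun _ _ h => Homotopic.inv h)

instance : One (K.LoopGroup v) where
  one := mk [] (isWalk_nil.2 rfl)

lemma mk_mul_mk (h : K.IsWalk v v l) (h' : K.IsWalk v v m) :
    mk l h * mk m h' = mk (l ++ m) (h.append h') := rfl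

lemma inv_mk (h : K.IsWalk v v l) : (mk l h)⁻¹ = mk (K.inv l) h.inv := rfl

lemma one_def : (1 : K.LoopGroup v) = mk [] (isWalk_nil.2 rfl) := rfl

instance : Group (K.LoopGroup v) :=
  Group.ofLeftAxioms
    (fun a b c => by
      obtain ⟨a, ha, rfl⟩ := exists_mk a
      obtain ⟨b, hb, rfl⟩ := exists_mk b
      obtain ⟨c, hc, rfl⟩ := exists_mk c
      simp [mk_mul_mk])
    (fun a => by
      obtain ⟨a, ha, rfl⟩ := exists_mk a
      simp [one_def, mk_mul_mk])
    (fun a => by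
      obtain ⟨a, ha, rfl⟩ := exists_mk a
      simpa [one_def, mk_mul_mk, inv_mk, mk_eq_mk] using Homotopic.inv_append ha)

end LoopGroup

section Tree

variable (K) (v : V)

open Classical in
/-- A chosen edge path from the base point `v` to `x`, if there is one. -/
noncomputable def treePath (x : V) : List D :=
  if h : ∃ l, K.IsWalk v x l then h.choose else []

variable {v}

lemma isWalk_treePath (h : ∃ l, K.IsWalk v x l) : K.IsWalk v x (K.treePath v x) := by
  rw [treePath, dif_pos h]
  exact h.choose_spec

variable (v)

open Classical in
/-- The class of a path that is made into a closed one by means of the chosen paths from the base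
point (and the trivial class for paths that cannot be reached from there). -/
noncomputable def treeClass (x y : V) (l : List D) : K.LoopGroup v :=
  if h : K.IsWalk v v (K.treePath v x ++ l ++ K.inv (K.treePath v y)) then LoopGroup.mk _ h else 1

variable {v} {K}

lemma treeClass_eq_mk (hx : ∃ l, K.IsWalk v x l) (h : K.IsWalk x y l) :
    ∃ h' : K.IsWalk v v (K.treePath v x ++ l ++ K.inv (K.treePath v y)),
      K.treeClass v x y l = LoopGroup.mk _ h' := by
  have hy : ∃ l, K.IsWalk v y l := ⟨_, (K.isWalk_treePath hx).append h⟩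
  have h' : K.IsWalk v v (K.treePath v x ++ l ++ K.inv (K.treePath v y)) :=
    ((K.isWalk_treePath hx).append h).append (K.isWalk_treePath hy).inv
  exact ⟨h', dif_pos h'⟩

lemma treeClass_congr (hx : ∃ l, K.IsWalk v x l) (h : K.Homotopic x y l m) :
    K.treeClass v x y l = K.treeClass v x y m := by
  have hy : ∃ l, K.IsWalk v y l := ⟨_, (K.isWalk_treePath hx).append h.isWalk.1⟩
  obtain ⟨h1, e1⟩ := treeClass_eq_mk hx h.isWalk.1
  obtain ⟨h2, e2⟩ := treeClass_eq_mk hx h.isWalk.2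
  rw [e1, e2, LoopGroup.mk_eq_mk]
  exact (h.append_left (K.isWalk_treePath hx)).append_right (K.isWalk_treePath hy).inv

lemma treeClass_nil (hx : ∃ l, K.IsWalk v x l) : K.treeClass v x x [] = 1 := by
  obtain ⟨h1, e1⟩ := treeClass_eq_mk hx (isWalk_nil.2 rfl)
  rw [e1, LoopGroup.one_def, LoopGroup.mk_eq_mk]
  simpa using Homotopic.append_inv (K.isWalk_treePath hx)

lemma treeClass_mul (hx : ∃ l, K.IsWalk v x l) (h : K.IsWalk x y l) (h' : K.IsWalk y z m) :
    K.treeClass v x y l * K.treeClass v y z m = K.treeClass v x z (l ++ m) := by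
  have hy : ∃ l, K.IsWalk v y l := ⟨_, (K.isWalk_treePath hx).append h⟩
  obtain ⟨h1, e1⟩ := treeClass_eq_mk hx h
  obtain ⟨h2, e2⟩ := treeClass_eq_mk hy h'
  obtain ⟨h3, e3⟩ := treeClass_eq_mk hx (h.append h')
  have hz : ∃ l, K.IsWalk v z l := ⟨_, (K.isWalk_treePath hy).append h'⟩
  rw [e1, e2, e3, LoopGroup.mk_mul_mk, LoopGroup.mk_eq_mk]
  have := ((Homotopic.inv_append (K.isWalk_treePath hy)).append_left
    ((K.isWalk_treePath hx).append h)).append_right (h'.append (K.isWalk_treePath hz).inv)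
  simpa using this

variable (K) (v) in
open Classical in
/-- The tautological holonomy in the fundamental group.  It is trivial on the components of the surface
that do not contain the base point. -/
noncomputable def treeHolonomy : K.Holonomy (K.LoopGroup v) where
  val d := if ∃ l, K.IsWalk v (K.src d) l then K.treeClass v (K.src d) (K.tgt d) [d] else 1
  val_rev d := by
    have hiff : (∃ l, K.IsWalk v (K.src (K.rev d)) l) ↔ ∃ l, K.IsWalk v (K.src d) l := by
      constructor
      · rintro ⟨l, hl⟩
        exact ⟨_, hl.append (m := [K.rev d]) ⟨rfl, by simp⟩⟩
      · rintro ⟨l, hl⟩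
        exact ⟨_, hl.append (m := [d]) ⟨rfl, by simp [tgt]⟩⟩
    simp only [hiff]
    split_ifs with h
    · have hd : K.IsWalk (K.src d) (K.tgt d) [d] := ⟨rfl, rfl⟩
      have hd' : K.IsWalk (K.tgt d) (K.src d) [K.rev d] := ⟨rfl, by simp⟩
      have hx : ∃ l, K.IsWalk v (K.tgt d) l := hiff.2 h
      rw [eq_inv_iff_mul_eq_one, src_rev, tgt_rev, treeClass_mul hx hd' hd,
        treeClass_congr hx (m := []) (by simpa using Homotopic.inv_append hd)]
      exact treeClass_nil hx
    · simp
  val_next d := by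
    have hiff : ∀ d, (∃ l, K.IsWalk v (K.src (K.next d)) l) ↔ ∃ l, K.IsWalk v (K.src d) l := by
      intro d
      constructor
      · rintro ⟨l, hl⟩
        exact ⟨_, hl.append (m := [K.rev d]) ⟨by simp [K.src_next], by simp⟩⟩
      · rintro ⟨l, hl⟩
        exact ⟨_, hl.append (m := [d]) ⟨rfl, by simp [K.src_next']⟩⟩
    simp only [hiff]
    split_ifs with h
    · have h1 : ∀ d, K.IsWalk (K.src d) (K.src (K.next d)) [d] := fun d => ⟨rfl, (K.src_next' d).symm⟩
      simp only [← K.src_next']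
      rw [treeClass_mul h (h1 _) (h1 _), treeClass_mul h ((h1 _).append (h1 _)) (h1 _),
        K.next_next_next, treeClass_congr h (m := []), treeClass_nil h]
      exact Homotopic.face (u := []) (w := []) d rfl rfl
    · simp

lemma hol_treeHolonomy (hx : ∃ l, K.IsWalk v x l) (h : K.IsWalk x y l) :
    (K.treeHolonomy v).hol l = K.treeClass v x y l := by
  induction l generalizing x with
  | nil =>
    obtain rfl : x = y := h
    exact (treeClass_nil hx).symm
  | cons d l ih =>
    obtain ⟨rfl, h⟩ := h
    have hd : K.IsWalk (K.src d) (K.tgt d) [d] := ⟨rfl, rfl⟩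
    rw [Holonomy.hol_cons, ih ⟨_, (K.isWalk_treePath hx).append hd⟩ h]
    simpa [treeHolonomy, hx] using treeClass_mul hx hd h

lemma hol_treeHolonomy_of_not (hx : ¬ ∃ l, K.IsWalk v x l) (h : K.IsWalk x y l) :
    (K.treeHolonomy v).hol l = 1 := by
  induction l generalizing x with
  | nil => rfl
  | cons d l ih =>
    obtain ⟨rfl, h⟩ := h
    rw [Holonomy.hol_cons, ih _ h]
    · simp [treeHolonomy, hx]
    · rintro ⟨m, hm⟩
      exact hx ⟨_, hm.append (m := [K.rev d]) ⟨rfl, by simp⟩⟩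

/-- The tautological holonomy detects free homotopy of essential closed paths. -/
lemma exists_homotopic_of_isConj {e : List D} (hl : K.IsWalk x x l) (he : K.IsWalk v v e)
    (h1 : (K.treeHolonomy v).hol l ≠ 1)
    (hc : IsConj ((K.treeHolonomy v).hol l) ((K.treeHolonomy v).hol e)) :
    ∃ p, K.IsWalk x v p ∧ K.Homotopic x x l (p ++ e ++ K.inv p) := by
  have hx : ∃ l, K.IsWalk v x l := by
    by_contra hx
    exact h1 (hol_treeHolonomy_of_not hx hl)
  have hv : ∃ l, K.IsWalk v v l := ⟨[], rfl⟩
  obtain ⟨g, hg⟩ := isConj_iff.1 hc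
  obtain ⟨u, hu, rfl⟩ := LoopGroup.exists_mk g
  rw [hol_treeHolonomy hx hl, hol_treeHolonomy hv he] at hg
  obtain ⟨h2, e2⟩ := treeClass_eq_mk hx hl
  obtain ⟨h3, e3⟩ := treeClass_eq_mk hv he
  rw [e2, e3, LoopGroup.inv_mk, LoopGroup.mk_mul_mk, LoopGroup.mk_mul_mk,
    LoopGroup.mk_eq_mk] at hg
  have hp := K.isWalk_treePath hx
  have hq := K.isWalk_treePath hv
  set p := K.treePath v x
  set q := K.treePath v v
  have hr : K.IsWalk x v (K.inv p ++ K.inv u ++ q) := (hp.inv.append hu.inv).append hq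
  refine ⟨_, hr, ?_⟩
  -- conjugate the homotopy of based loops by `p⁻¹ u⁻¹`
  have key := (hg.append_left (hp.inv.append hu.inv)).append_right (hu.append hp)
  have h5 := (Homotopic.inv_append (hu.append hp)).append_right
    ((hl.append ((Homotopic.inv_append (hu.append hp)).isWalk.1)))
  have h6 := (Homotopic.inv_append (hu.append hp)).append_left hl
  simp only [inv_append, inv_inv, List.append_assoc, List.nil_append, List.append_nil] at *
  exact (h5.trans h6).symm.trans key

lemma homotopic_nil_of_hol_eq_one (hl : K.IsWalk v v l) (h1 : (K.treeHolonomy v).hol l = 1) :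
    K.Homotopic v v l [] := by
  have hv : ∃ l, K.IsWalk v v l := ⟨[], rfl⟩
  rw [hol_treeHolonomy hv hl] at h1
  obtain ⟨h2, e2⟩ := treeClass_eq_mk hv hl
  rw [e2, LoopGroup.one_def, LoopGroup.mk_eq_mk] at h1
  have hp := K.isWalk_treePath hv
  set p := K.treePath v v
  have h3 := (h1.append_left hp.inv).append_right hp
  have h4 := Homotopic.inv_append hp
  have h5 := h4.append_right (hl.append h4.isWalk.1)
  have h6 := h4.append_left hl
  simp only [List.append_assoc, List.nil_append, List.append_nil] at *
  exact (h5.trans h6).symm.trans (h3.trans h4)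

end Tree

end OrientedTriangulation

namespace OrientedTriangulation

variable {D V : Type*} {K : OrientedTriangulation D V} {x y z : V} {l l' m m' : List D}

/-! ### Simplicial chains -/

section Chains

open Classical in
variable (K) in
/-- The simplicial 1-chain carried by a list of darts, as an antisymmetric function on darts. -/
noncomputable def chain (l : List D) (d : D) : ℤ := l.count d - l.count (K.rev d)

@[simp] lemma chain_nil (d : D) : K.chain [] d = 0 := by simp [chain]

@[simp] lemma chain_append (d : D) : K.chain (l ++ m) d = K.chain l d + K.chain m d := by
  simp only [chain, List.count_append]
  push_cast
  ring

lemma chain_cons (e d : D) : K.chain (e :: l) d = K.chain [e] d + K.chain l d :=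
  chain_append (l := [e]) d

lemma rev_injective : Function.Injective K.rev :=
  Function.LeftInverse.injective (g := K.rev) K.rev_rev

lemma next_injective : Function.Injective K.next :=
  Function.LeftInverse.injective (g := fun d => K.next (K.next d)) K.next_next_next

lemma chain_rev (d : D) : K.chain l (K.rev d) = -K.chain l d := by
  simp [chain, K.rev_rev]

lemma chain_map_rev (d : D) : K.chain (l.map K.rev) d = -K.chain l d := by
  classical
  have h : ∀ e, (l.map K.rev).count (K.rev e) = l.count e :=
    fun e => List.count_map_of_injective _ _ rev_injective _
  have h2 := h (K.rev d)
  rw [K.rev_rev] at h2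
  simp only [chain]
  rw [h2, h]
  ring

@[simp] lemma chain_inv (d : D) : K.chain (K.inv l) d = -K.chain l d := by
  rw [← chain_map_rev]
  simp [chain, inv]

lemma chain_spur (e d : D) : K.chain [e, K.rev e] d = 0 := by
  rw [chain_cons, show [K.rev e] = K.inv [e] by simp, chain_inv, add_neg_cancel]

/-- Homotopic edge paths are homologous: the chains that they carry differ by the boundary of a finite
2-chain, which is a function on darts that is constant on the three sides of each triangle. -/
lemma Homotopic.homologous (h : K.Homotopic x y l m) :
    ∃ c : D →₀ ℤ, (∀ d, c (K.next d) = c d) ∧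
      ∀ d, K.chain l d = K.chain m d + c d - c (K.rev d) := by
  classical
  induction h with
  | refl _ => exact ⟨0, by simp, by simp⟩
  | symm _ ih =>
    obtain ⟨c, h1, h2⟩ := ih
    refine ⟨-c, by simp [h1], fun d => ?_⟩
    simp only [Finsupp.coe_neg, Pi.neg_apply]
    linarith [h2 d]
  | trans _ _ ih ih' =>
    obtain ⟨c, h1, h2⟩ := ih
    obtain ⟨c', h1', h2'⟩ := ih'
    refine ⟨c + c', by simp [h1, h1'], fun d => ?_⟩
    simp only [Finsupp.coe_add, Pi.add_apply]
    linarith [h2 d, h2' d]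
  | @spur u w e _ _ =>
    refine ⟨0, by simp, fun d => ?_⟩
    have := chain_append (K := K) (l := [e, K.rev e]) (m := w) d
    simp only [List.cons_append, List.nil_append] at this
    simp [this, chain_spur]
  | @face u w e _ _ =>
    have hs : ∀ a d : D, Finsupp.single (K.next a) (1 : ℤ) (K.next d) = Finsupp.single a 1 d := by
      intro a d
      simp [Finsupp.single_apply, next_injective.eq_iff]
    have hs' : ∀ d, Finsupp.single e (1 : ℤ) (K.next d)
        = Finsupp.single (K.next (K.next e)) 1 d := by
      intro d
      rw [← hs (K.next (K.next e)), K.next_next_next]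
    refine ⟨.single e 1 + .single (K.next e) 1 + .single (K.next (K.next e)) 1, fun d => ?_,
      fun d => ?_⟩
    · simp only [Finsupp.coe_add, Pi.add_apply, hs, hs']
      ring
    · have := chain_append (K := K) (l := [e, K.next e, K.next (K.next e)]) (m := w) d
      simp only [List.cons_append, List.nil_append] at this
      rw [chain_append, this, chain_append]
      simp only [chain, List.count_cons, List.count_nil, Finsupp.coe_add,
        Pi.add_apply, Finsupp.single_apply, beq_iff_eq]
      push_cast
      ring

lemma sum_eq_zero_of_next {A : Type*} [AddCommGroup A] (f : D → A)
    (hf : ∀ d, f d + f (K.next d) + f (K.next (K.next d)) = 0) (s : Finset D)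
    (hs : ∀ d ∈ s, K.next d ∈ s) : ∑ d ∈ s, f d = 0 := by
  classical
  induction hn : s.card using Nat.strong_induction_on generalizing s with
  | _ n ih =>
    rcases s.eq_empty_or_nonempty with rfl | ⟨d, hd⟩
    · simp
    have h1 : d ≠ K.next d := (K.next_ne d).symm
    have h2 : K.next d ≠ K.next (K.next d) := (K.next_ne _).symm
    have h3 : d ≠ K.next (K.next d) := fun h => h1 (by
      conv_lhs => rw [← K.next_next_next d, ← h])
    have ht : ({d, K.next d, K.next (K.next d)} : Finset D) ⊆ s := by
      intro e he
      simp only [Finset.mem_insert, Finset.mem_singleton] at he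
      rcases he with rfl | rfl | rfl
      · exact hd
      · exact hs _ hd
      · exact hs _ (hs _ hd)
    have hlt : (s \ {d, K.next d, K.next (K.next d)}).card < n := by
      rw [← hn]
      exact Finset.card_lt_card ⟨Finset.sdiff_subset, fun h => by simpa using h hd⟩
    rw [← Finset.sum_sdiff ht, ih _ hlt _ ?_ rfl, zero_add, Finset.sum_insert (by simp [h1, h3]),
      Finset.sum_insert (by simp [h2]), Finset.sum_singleton, ← add_assoc, hf]
    intro e he
    simp only [Finset.mem_sdiff, Finset.mem_insert, Finset.mem_singleton, not_or] at he ⊢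
    refine ⟨hs _ he.1, fun h => he.2.2.2 ?_, fun h => he.2.1 ?_, fun h => he.2.2.1 ?_⟩
    · rw [← h, K.next_next_next]
    · exact next_injective h
    · exact next_injective h

/-- A map on darts that respects reversal and triangles takes the same value on homologous cycles.
Here the cycle `c + ∂a`, with values `f d`, is represented by the darts on which it is positive. -/
lemma sum_toNat_eq {A : Type*} [AddCommGroup A] (ψ : D → A) (h_rev : ∀ d, ψ (K.rev d) = -ψ d)
    (h_next : ∀ d, ψ d + ψ (K.next d) + ψ (K.next (K.next d)) = 0) (c : List D) (a : D →₀ ℤ)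
    (ha : ∀ d, a (K.next d) = a d) (f : D → ℤ)
    (hf : ∀ d, f d = K.chain c d + a d - a (K.rev d)) (F : Finset D)
    (hF : ∀ d ∈ F, K.rev d ∈ F) (hc : ∀ d ∈ c, d ∈ F) (haF : a.support ⊆ F) :
    ∑ d ∈ F, (f d).toNat • ψ d = (c.map ψ).sum := by
  classical
  have e1 : (c.map ψ).sum = ∑ d ∈ F, (c.count d : ℤ) • ψ d := by
    rw [Finset.sum_list_map_count]
    simp only [natCast_zsmul]
    refine Finset.sum_subset (fun d hd => hc d (by simpa using hd)) fun d _ hd => ?_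
    rw [List.count_eq_zero_of_not_mem (by simpa using hd), zero_smul]
  have e2 : ∑ d ∈ F, a d • ψ d = 0 := by
    rw [← Finset.sum_subset haF (fun d _ hd => by simp [Finsupp.notMem_support_iff.1 hd])]
    refine sum_eq_zero_of_next _ (fun d => ?_) _
      (fun d hd => by rwa [Finsupp.mem_support_iff, ha, ← Finsupp.mem_support_iff])
    rw [ha, ha, ha, ← smul_add, ← smul_add, h_next, smul_zero]
  have e3 : ∑ d ∈ F, (((f d).toNat : ℤ) - c.count d - a d) • ψ d = 0 := by
    refine Finset.sum_involution (fun d _ => K.rev d) (fun d hd => ?_) (fun d _ _ => K.rev_ne d)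
      (fun d hd => hF d hd) (fun d _ => K.rev_rev d)
    have : ((f (K.rev d)).toNat : ℤ) - c.count (K.rev d) - a (K.rev d)
        = (f d).toNat - c.count d - a d := by
      have h1 := hf d
      have h2 := hf (K.rev d)
      rw [chain_rev, K.rev_rev] at h2
      simp only [chain] at h1 h2
      omega
    rw [this, h_rev, smul_neg, add_neg_cancel]
  simp only [sub_smul, Finset.sum_sub_distrib, e2, natCast_zsmul, sub_zero] at e3
  rw [e1, sub_eq_zero.1 e3]
  simp

lemma sum_map_eq_add_of_le {A : Type*} [AddCommMonoid A] [DecidableEq D] (f : D → A)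
    {m : Multiset D} (h : (l : Multiset D) ≤ m) :
    (m.map f).sum = (l.map f).sum + ((m - l).map f).sum := by
  conv_lhs => rw [← Multiset.sub_add_cancel h]
  simp [add_comm]

lemma sum_map_sum_nsmul {A : Type*} [AddCommMonoid A] (F : Finset D) (f : D → ℕ) (g : D → A) :
    ((∑ d ∈ F, f d • {d} : Multiset D).map g).sum = ∑ d ∈ F, f d • g d := by
  rw [← Multiset.coe_mapAddMonoidHom, ← Multiset.coe_sumAddMonoidHom, map_sum, map_sum]
  simp [Multiset.map_nsmul, Multiset.sum_nsmul]

variable (K) in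
/-- The boundary of a dart as a 0-chain. -/
noncomputable def vertexBoundary (d : D) : V →₀ ℤ := .single (K.tgt d) 1 - .single (K.src d) 1

lemma IsWalk.sum_vertexBoundary (h : K.IsWalk x y l) :
    (l.map K.vertexBoundary).sum = .single y 1 - .single x 1 := by
  induction l generalizing x with
  | nil =>
    obtain rfl : x = y := h
    simp
  | cons d l ih =>
    obtain ⟨rfl, h⟩ := h
    rw [List.map_cons, List.sum_cons, ih h, vertexBoundary]
    abel

lemma exists_closed_le (m : Multiset D) (hm : (m.map K.vertexBoundary).sum = 0) (h0 : m ≠ 0) :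
    ∃ v l, l ≠ [] ∧ K.IsWalk v v l ∧ (l : Multiset D) ≤ m := by
  classical
  by_contra hno
  -- a walk that is not closed can be prolonged, since `m` is balanced at its end
  have key : ∀ n : ℕ, ∃ (x y : V) (l : List D), l.length = n + 1 ∧ K.IsWalk x y l ∧
      (l : Multiset D) ≤ m := by
    intro n
    induction n with
    | zero =>
      obtain ⟨d, hd⟩ := Multiset.exists_mem_of_ne_zero h0
      exact ⟨_, _, [d], rfl, ⟨rfl, rfl⟩, by simpa using hd⟩
    | succ n ih =>
      obtain ⟨x, y, l, hl, hw, hle⟩ := ih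
      have hxy : x ≠ y := by
        rintro rfl
        exact hno ⟨x, l, by rintro rfl; simp at hl, hw, hle⟩
      have hr : (((m - l).map K.vertexBoundary).sum) y = -1 := by
        have h1 := sum_map_eq_add_of_le K.vertexBoundary hle
        rw [hm, hw.sum_vertexBoundary] at h1
        have h2 := DFunLike.congr_fun h1 y
        simp [hxy] at h2
        linarith
      have hd : ∃ d ∈ m - l, K.src d = y := by
        by_contra! hd
        have : 0 ≤ (((m - l).map K.vertexBoundary).sum) y := by
          rw [← Finsupp.applyAddHom_apply, map_multiset_sum]
          refine Multiset.sum_nonneg fun a ha => ?_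
          simp only [Multiset.mem_map] at ha
          obtain ⟨_, ⟨d, h, rfl⟩, rfl⟩ := ha
          have := hd d h
          simp only [Finsupp.applyAddHom_apply, vertexBoundary, Finsupp.coe_sub, Pi.sub_apply,
            Finsupp.single_apply, this, if_false]
          split_ifs <;> simp
        omega
      obtain ⟨d, hd, rfl⟩ := hd
      refine ⟨x, K.tgt d, l ++ [d], by simp [hl], hw.append ⟨rfl, rfl⟩, ?_⟩
      calc ((l ++ [d] : List D) : Multiset D)
        _ = (l : Multiset D) + {d} := by rw [← Multiset.coe_add, Multiset.coe_singleton]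
        _ ≤ l + (m - l) := add_le_add_right (by simpa using hd) _
        _ = m := by rw [add_comm, Multiset.sub_add_cancel hle]
  obtain ⟨x, y, l, hl, _, hle⟩ := key (Multiset.card m)
  have := Multiset.card_le_card hle
  simp [hl] at this

/-- A balanced multiset of darts is a union of closed walks, so one of these is not annihilated by a
homomorphism that does not annihilate the whole. -/
lemma exists_closed_sum_ne_zero {A : Type*} [AddCommGroup A] (ψ : D → A) (m : Multiset D)
    (hm : (m.map K.vertexBoundary).sum = 0) (h0 : (m.map ψ).sum ≠ 0) :
    ∃ v l, K.IsWalk v v l ∧ (l : Multiset D) ≤ m ∧ (l.map ψ).sum ≠ 0 := by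
  classical
  induction hn : Multiset.card m using Nat.strong_induction_on generalizing m with
  | _ n ih =>
    have hne : m ≠ 0 := by
      rintro rfl
      simp at h0
    obtain ⟨v, l, hl, hw, hle⟩ := exists_closed_le m hm hne
    by_cases hψ : (l.map ψ).sum = 0
    · have hcard : Multiset.card (m - (l : Multiset D)) < n := by
        rw [Multiset.card_sub hle, ← hn]
        have h1 : 0 < l.length := List.length_pos_iff.2 hl
        have h2 := Multiset.card_le_card hle
        simp only [Multiset.coe_card] at h2 ⊢
        omega
      have hbal := sum_map_eq_add_of_le K.vertexBoundary hle
      rw [hm, hw.sum_vertexBoundary, sub_self, zero_add, eq_comm] at hbal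
      have hne := sum_map_eq_add_of_le ψ hle
      rw [hψ, zero_add] at hne
      obtain ⟨v', l', h1, h2, h3⟩ := ih _ hcard _ hbal (hne ▸ h0) rfl
      exact ⟨v', l', h1, h2.trans (Multiset.sub_le_self _ _), h3⟩
    · exact ⟨v, l, hw, hle, hψ⟩

end Chains

/-! ### The coarea argument -/

/-- Hermite's identity. -/
lemma sum_add_ediv (k : ℕ) (hk : 0 < k) (a : ℤ) : ∑ j ∈ Finset.range k, (a + j) / (k : ℤ) = a := by
  have hk' : (k : ℤ) ≠ 0 := by positivity
  have hstep : ∀ a : ℤ, ∑ j ∈ Finset.range k, (a + 1 + j) / (k : ℤ)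
      = ∑ j ∈ Finset.range k, (a + j) / (k : ℤ) + 1 := by
    intro a
    have h1 := Finset.sum_range_succ (fun j : ℕ => (a + j) / (k : ℤ)) k
    have h2 := Finset.sum_range_succ' (fun j : ℕ => (a + j) / (k : ℤ)) k
    have h3 : (a + k) / (k : ℤ) = a / k + 1 := Int.add_ediv_of_dvd_right (dvd_refl _) ▸ by
      rw [Int.ediv_self hk']
    simp only [h3, Nat.cast_zero, add_zero, Nat.cast_add, Nat.cast_one] at h1 h2
    have h4 : ∀ j : ℕ, a + ((j : ℤ) + 1) = a + 1 + j := fun j => by ring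
    simp only [h4] at h2
    linarith
  induction a with
  | zero =>
    refine Finset.sum_eq_zero fun j hj => ?_
    have := Finset.mem_range.1 hj
    rw [zero_add]
    exact Int.ediv_eq_zero_of_lt (by positivity) (by exact_mod_cast this)
  | succ i ih => rw [hstep, ih]
  | pred i ih =>
    have := hstep (-(i : ℤ) - 1)
    rw [sub_add_cancel, ih] at this
    linarith

lemma sum_toNat_ediv (k : ℕ) (hk : 0 < k) (p q : ℤ) :
    ∑ j ∈ Finset.range k, ((p + j) / (k : ℤ) - (q + j) / (k : ℤ)).toNat = (p - q).toNat := by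
  have hk' : (0 : ℤ) < k := by exact_mod_cast hk
  rcases le_total q p with h | h
  · have h1 : ∀ j : ℕ, 0 ≤ (p + j) / (k : ℤ) - (q + j) / (k : ℤ) := fun j =>
      sub_nonneg.2 (Int.ediv_le_ediv hk' (by linarith))
    zify
    simp only [Int.toNat_of_nonneg (h1 _), Int.toNat_of_nonneg (sub_nonneg.2 h)]
    rw [Finset.sum_sub_distrib, sum_add_ediv k hk, sum_add_ediv k hk]
  · rw [Int.toNat_of_nonpos (by linarith)]
    refine Finset.sum_eq_zero fun j _ => Int.toNat_of_nonpos ?_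
    exact sub_nonpos.2 (Int.ediv_le_ediv hk' (by linarith))

/-- If the closed path `c` is not annihilated by the cocycle `ψ` and `z` is homologous to `k` times
`c`, say `z = k c + ∂a`, then some closed path is at most `1 / k` times as long as `z` and not
annihilated by `ψ`.  In fact the cycles `c + ∂ ⌊(a + j) / k⌋` for `0 ≤ j < k` have the same total length
as `z`, and each of them is a union of closed paths. -/
theorem exists_closed_mul_length_le {A : Type*} [AddCommGroup A] (ψ : D → A)
    (h_rev : ∀ d, ψ (K.rev d) = -ψ d)
    (h_next : ∀ d, ψ d + ψ (K.next d) + ψ (K.next (K.next d)) = 0)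
    (len : D → ℝ) (h_len : ∀ d, 0 ≤ len d)
    (c : List D) (hc : K.IsWalk x x c) (h0 : (c.map ψ).sum ≠ 0) (z : List D) (k : ℕ) (hk : 0 < k)
    (a : D →₀ ℤ) (ha : ∀ d, a (K.next d) = a d)
    (hz : ∀ d, K.chain z d = k * K.chain c d + a d - a (K.rev d)) :
    ∃ v l, K.IsWalk v v l ∧ (l.map ψ).sum ≠ 0 ∧ k * (l.map len).sum ≤ (z.map len).sum := by
  classical
  have hk' : (k : ℤ) ≠ 0 := by positivity
  set F₀ : Finset D := c.toFinset ∪ z.toFinset ∪ a.support with hF₀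
  set F : Finset D := F₀ ∪ F₀.image K.rev with hF
  have hFrev : ∀ d ∈ F, K.rev d ∈ F := by
    intro d hd
    rcases Finset.mem_union.1 hd with hd | hd
    · exact Finset.mem_union_right _ (Finset.mem_image_of_mem _ hd)
    · obtain ⟨e, he, rfl⟩ := Finset.mem_image.1 hd
      rw [K.rev_rev]
      exact Finset.mem_union_left _ he
  have hFc : ∀ d ∈ c, d ∈ F := fun d hd => by simp [hF, hF₀, hd]
  have hFz : ∀ d ∈ z, d ∈ F := fun d hd => by simp [hF, hF₀, hd]
  have hFa : a.support ⊆ F := fun d hd => by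
    simp only [hF, hF₀, Finset.mem_union]
    exact Or.inl (Or.inr hd)
  -- the function `⌊(a + j) / k⌋`
  have hlev : ∀ j ∈ Finset.range k, ((0 : ℤ) + (j : ℤ)) / (k : ℤ) = 0 := fun j hj => by
    rw [zero_add]
    exact Int.ediv_eq_zero_of_lt (by positivity) (by exact_mod_cast Finset.mem_range.1 hj)
  set f : ℕ → D → ℤ := fun j d =>
    K.chain c d + (a d + j) / (k : ℤ) - (a (K.rev d) + j) / (k : ℤ) with hf
  set ms : ℕ → Multiset D := fun j => ∑ d ∈ F, (f j d).toNat • {d} with hms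
  -- one of the `k` cycles is short
  obtain ⟨j, hj, hjlen⟩ : ∃ j ∈ Finset.range k,
      k * ∑ d ∈ F, (f j d).toNat • len d ≤ (z.map len).sum := by
    apply Finset.exists_le_of_sum_le (Finset.nonempty_range_iff.2 hk.ne')
    rw [← Finset.mul_sum, Finset.sum_comm, Finset.sum_const, Finset.card_range, nsmul_eq_mul]
    gcongr
    have hd : ∀ d ∈ F, ∑ j ∈ Finset.range k, (f j d).toNat • len d ≤ z.count d • len d := by
      intro d _
      rw [← Finset.sum_smul]
      refine nsmul_le_nsmul_left (h_len d) ?_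
      have h1 : ∀ j : ℕ, f j d
          = (a d + k * K.chain c d + j) / (k : ℤ) - (a (K.rev d) + j) / (k : ℤ) := by
        intro j
        have : a d + k * K.chain c d + j = (a d + j) + k * K.chain c d := by ring
        rw [this, Int.add_mul_ediv_left _ _ hk']
        simp only [hf]
        ring
      simp only [h1]
      rw [sum_toNat_ediv k hk]
      have h2 := hz d
      simp only [chain] at h2 ⊢
      omega
    refine (Finset.sum_le_sum hd).trans_eq ?_
    rw [Finset.sum_list_map_count]
    refine (Finset.sum_subset (fun d hd => hFz d (by simpa using hd)) fun d _ hd => ?_).symm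
    rw [List.count_eq_zero_of_not_mem (by simpa using hd), zero_smul]
  have ha' : ∀ d, (a.mapRange (fun t => (t + j) / (k : ℤ)) (hlev j hj)) (K.next d)
      = (a.mapRange (fun t => (t + j) / (k : ℤ)) (hlev j hj)) d := fun d => by simp [ha]
  have hf' : ∀ d, f j d = K.chain c d + (a.mapRange (fun t => (t + j) / (k : ℤ)) (hlev j hj)) d
      - (a.mapRange (fun t => (t + j) / (k : ℤ)) (hlev j hj)) (K.rev d) := fun d => by simp [hf]
  have haF := (Finsupp.support_mapRange (f := fun t : ℤ => (t + j) / (k : ℤ))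
    (hf := hlev j hj) (g := a)).trans hFa
  have hbal : ((ms j).map K.vertexBoundary).sum = 0 := by
    rw [sum_map_sum_nsmul, sum_toNat_eq _ (fun d => ?_) (fun d => ?_) c _ ha' _ hf' F hFrev hFc haF,
      hc.sum_vertexBoundary, sub_self]
    · simp [vertexBoundary, src_rev]
    · simp only [vertexBoundary, src_next', tgt_next_next]
      abel
  have hψ : ((ms j).map ψ).sum ≠ 0 := by
    rwa [sum_map_sum_nsmul, sum_toNat_eq ψ h_rev h_next c _ ha' _ hf' F hFrev hFc haF]
  obtain ⟨v, l, hl, hle, hne⟩ := exists_closed_sum_ne_zero ψ (ms j) hbal hψ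
  refine ⟨v, l, hl, hne, le_trans ?_ hjlen⟩
  rw [← sum_map_sum_nsmul, sum_map_eq_add_of_le len hle]
  gcongr
  refine le_add_of_nonneg_right (Multiset.sum_nonneg fun r hr => ?_)
  obtain ⟨d, _, rfl⟩ := Multiset.mem_map.1 hr
  exact h_len d

end OrientedTriangulation

namespace OrientedTriangulation

variable {D V : Type*} {K : OrientedTriangulation D V} {x y z v : V} {l l' m m' : List D}

/-! ### Covering surfaces -/

section Cover

variable {G : Type*} [Group G] (ω : K.Holonomy G) {Q : Type*} [MulAction G Q]

variable (Q) in
/-- The covering of the surface with fibre `Q` and holonomy `ω`.  Going along a dart `d` moves the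
fibre by `(ω d)⁻¹`, so that the holonomy of a path acts by its inverse. -/
def cover : OrientedTriangulation (Q × D) (Q × V) where
  src e := (e.1, K.src e.2)
  rev e := ((ω.val e.2)⁻¹ • e.1, K.rev e.2)
  next e := ((ω.val e.2)⁻¹ • e.1, K.next e.2)
  rev_rev e := by simp [ω.val_rev, K.rev_rev]
  rev_ne e h := K.rev_ne e.2 (congrArg Prod.snd h)
  next_next_next e := by
    have h : (ω.val (K.next (K.next e.2)))⁻¹ * ((ω.val (K.next e.2))⁻¹ * (ω.val e.2)⁻¹) = 1 := by
      rw [← mul_inv_rev, ← mul_inv_rev, ω.val_next, inv_one]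
    simp [K.next_next_next, smul_smul, h]
  next_ne e h := K.next_ne e.2 (congrArg Prod.snd h)
  src_next e := by simp [K.src_next]

lemma cover_rev (q : Q) (d : D) :
    (cover ω Q).rev (q, d) = ((ω.val d)⁻¹ • q, K.rev d) := rfl

lemma cover_next (q : Q) (d : D) :
    (cover ω Q).next (q, d) = ((ω.val d)⁻¹ • q, K.next d) := rfl

lemma cover_tgt (q : Q) (d : D) : (cover ω Q).tgt (q, d) = ((ω.val d)⁻¹ • q, K.tgt d) := rfl

/-- The lift of an edge path to the covering, starting at the point `q` of the fibre. -/
def lift : Q → List D → List (Q × D)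
  | _, [] => []
  | q, d :: l => (q, d) :: lift ((ω.val d)⁻¹ • q) l

variable {ω} {q q' : Q}

@[simp] lemma map_snd_lift : (lift ω q l).map Prod.snd = l := by
  induction l generalizing q with
  | nil => rfl
  | cons d l ih => simp [lift, ih]

lemma lift_append : lift ω q (l ++ m) = lift ω q l ++ lift ω ((ω.hol l)⁻¹ • q) m := by
  induction l generalizing q with
  | nil => simp [lift]
  | cons d l ih => simp [lift, ih, mul_smul]

lemma IsWalk.lift (h : K.IsWalk x y l) (q : Q) :
    (cover ω Q).IsWalk (q, x) ((ω.hol l)⁻¹ • q, y) (lift ω q l) := by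
  induction l generalizing q x with
  | nil =>
    obtain rfl : x = y := h
    simp [OrientedTriangulation.lift]
  | cons d l ih =>
    obtain ⟨rfl, h⟩ := h
    refine ⟨rfl, ?_⟩
    simpa [mul_smul, cover_tgt] using ih h ((ω.val d)⁻¹ • q)

lemma eq_lift_of_isWalk {L : List (Q × D)} (h : (cover ω Q).IsWalk (q, x) (q', y) L) :
    K.IsWalk x y (L.map Prod.snd) ∧ L = lift ω q (L.map Prod.snd) ∧
      (ω.hol (L.map Prod.snd))⁻¹ • q = q' := by
  induction L generalizing q x with
  | nil =>
    obtain ⟨rfl, rfl⟩ := Prod.mk.inj h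
    simp [lift]
  | cons e L ih =>
    obtain ⟨q₀, d⟩ := e
    obtain ⟨h1, h2⟩ := h
    obtain ⟨rfl, rfl⟩ := Prod.mk.inj h1
    rw [cover_tgt] at h2
    obtain ⟨i1, i2, i3⟩ := ih h2
    refine ⟨⟨rfl, i1⟩, ?_, ?_⟩
    · simpa [lift] using i2
    · simpa [mul_smul] using i3

lemma inv_lift : (cover ω Q).inv (lift ω q l) = lift ω ((ω.hol l)⁻¹ • q) (K.inv l) := by
  induction l generalizing q with
  | nil => simp [lift]
  | cons d l ih => simp [lift, ih, lift_append, mul_smul, cover_rev]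

lemma Homotopic.lift (h : K.Homotopic x y l m) (q : Q) :
    (cover ω Q).Homotopic (q, x) ((ω.hol l)⁻¹ • q, y) (lift ω q l) (lift ω q m) := by
  induction h with
  | refl h => exact .refl (h.lift q)
  | symm h ih => exact (ω.hol_eq h ▸ ih).symm
  | trans h _ ih ih' => exact ih.trans (ω.hol_eq h ▸ ih')
  | @spur u w d hu hw =>
    have hol : ω.hol (u ++ d :: K.rev d :: w) = ω.hol (u ++ w) := ω.hol_eq (.spur d hu hw)
    rw [hol]
    have h1 := hw.lift (ω := ω) ((ω.hol u)⁻¹ • q)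
    have := Homotopic.spur (K := cover ω Q) ((ω.hol u)⁻¹ • q, d) (hu.lift q) h1
    simpa [lift_append, OrientedTriangulation.lift, cover_rev, ω.val_rev, mul_smul] using this
  | @face u w d hu hw =>
    have hol : ω.hol (u ++ d :: K.next d :: K.next (K.next d) :: w) = ω.hol (u ++ w) :=
      ω.hol_eq (.face d hu hw)
    rw [hol]
    have h1 := hw.lift (ω := ω) ((ω.hol u)⁻¹ • q)
    have := Homotopic.face (K := cover ω Q) ((ω.hol u)⁻¹ • q, d) (hu.lift q) h1
    have h2 : (ω.val (K.next (K.next d)))⁻¹ • (ω.val (K.next d))⁻¹ • (ω.val d)⁻¹ •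
        (ω.hol u)⁻¹ • q = (ω.hol u)⁻¹ • q := by
      rw [smul_smul, smul_smul, ← mul_inv_rev, ← mul_inv_rev, ← mul_assoc, ω.val_next, inv_one,
        one_smul]
    simpa [lift_append, OrientedTriangulation.lift, cover_next, h2, mul_smul] using this

/-- The path traversed `k` times. -/
def power (l : List D) (k : ℕ) : List D := (List.replicate k l).flatten

lemma power_succ (k : ℕ) : power l (k + 1) = l ++ power l k := by
  simp [power, List.replicate_succ]

lemma IsWalk.power (h : K.IsWalk v v l) (k : ℕ) : K.IsWalk v v (power l k) := by
  induction k with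
  | zero => exact rfl
  | succ k ih => rw [power_succ]; exact h.append ih

lemma Holonomy.hol_power (k : ℕ) : ω.hol (OrientedTriangulation.power l k) = ω.hol l ^ k := by
  induction k with
  | zero => simp [OrientedTriangulation.power]
  | succ k ih => rw [power_succ, hol_append, ih, pow_succ']

lemma smul_hol_power (h : (ω.hol l)⁻¹ • q = q) (k : ℕ) : (ω.hol (power l k))⁻¹ • q = q := by
  induction k with
  | zero => simp [power]
  | succ k ih => rw [power_succ, Holonomy.hol_append, mul_inv_rev, mul_smul, h, ih]

lemma chain_lift_power (h : (ω.hol l)⁻¹ • q = q) (k : ℕ) (e : Q × D) :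
    (cover ω Q).chain (lift ω q (power l k)) e = k * (cover ω Q).chain (lift ω q l) e := by
  induction k with
  | zero => simp [power, lift]
  | succ k ih =>
    rw [power_succ, lift_append, h, chain_append, ih]
    push_cast
    ring

end Cover

/-! ### Shortest closed paths in the multiples of a homotopy class -/

section Cyclic

variable {G : Type*} [Group G] (ω : K.Holonomy G) (S : G)

/-- The holonomy of a dart of the covering with fibre `G ⧸ ⟨S⟩`, measured in the cyclic group `⟨S⟩` by
means of coset representatives. -/
noncomputable def cosetHolonomy (g : G) (q : G ⧸ Subgroup.zpowers S) : Subgroup.zpowers S :=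
  ⟨q.out⁻¹ * (g * (g⁻¹ • q).out), by
    rw [← QuotientGroup.eq, QuotientGroup.out_eq', ← smul_eq_mul, MulAction.Quotient.coe_smul_out,
      smul_inv_smul]⟩

variable {S}

lemma cosetHolonomy_mul (g h : G) (q : G ⧸ Subgroup.zpowers S) :
    cosetHolonomy S (g * h) q = cosetHolonomy S g q * cosetHolonomy S h (g⁻¹ • q) := by
  ext
  simp [cosetHolonomy, mul_smul, mul_assoc]

lemma cosetHolonomy_one (q : G ⧸ Subgroup.zpowers S) : cosetHolonomy S 1 q = 1 := by
  ext
  simp [cosetHolonomy]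

variable {ω} in
/-- The coarea argument in the annular covering, the covering with fundamental group `⟨S⟩`. -/
lemma exists_conj_zpow_mul_length_le {s : List D} (hs : K.IsWalk v v s) (hS : ω.hol s = S)
    (hS1 : S ≠ 1) (len : D → ℝ) (h_len : ∀ d, 0 ≤ len d)
    (z : List ((G ⧸ Subgroup.zpowers S) × D)) (k : ℕ) (hk : 0 < k)
    (a : ((G ⧸ Subgroup.zpowers S) × D) →₀ ℤ) (ha : ∀ d, a ((cover ω _).next d) = a d)
    (hz : ∀ d, (cover ω _).chain z d
      = k * (cover ω _).chain (lift ω ((1 : G) : G ⧸ Subgroup.zpowers S) s) d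
        + a d - a ((cover ω _).rev d)) :
    ∃ y l, K.IsWalk y y l ∧ ω.hol l ≠ 1 ∧ (∃ n : ℤ, IsConj (S ^ n) (ω.hol l)) ∧
      k * (l.map len).sum ≤ (z.map fun e => len e.2).sum := by
  let _ : CommGroup (Subgroup.zpowers S) :=
    { (inferInstance : Group (Subgroup.zpowers S)) with
      mul_comm := fun a b => Std.Commutative.comm a b }
  set ψ : (G ⧸ Subgroup.zpowers S) × D → Additive (Subgroup.zpowers S) :=
    fun e => Additive.ofMul (cosetHolonomy S (ω.val e.2) e.1) with hψ
  have hsum : ∀ (l : List D) (q : G ⧸ Subgroup.zpowers S),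
      ((lift ω q l).map ψ).sum = Additive.ofMul (cosetHolonomy S (ω.hol l) q) := by
    intro l
    induction l with
    | nil => intro q; simp [lift, cosetHolonomy_one]
    | cons d l ih =>
      intro q
      rw [lift, List.map_cons, List.sum_cons, ih, Holonomy.hol_cons, cosetHolonomy_mul]
      rfl
  have hfix : S⁻¹ • ((1 : G) : G ⧸ Subgroup.zpowers S) = ((1 : G) : G ⧸ Subgroup.zpowers S) := by
    rw [MulAction.Quotient.smul_coe, QuotientGroup.eq]
    simp
  have hc := hs.lift (ω := ω) ((1 : G) : G ⧸ Subgroup.zpowers S)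
  rw [hS, hfix] at hc
  have hval : ∀ {g : G} {q : G ⧸ Subgroup.zpowers S}, g⁻¹ • q = q →
      (cosetHolonomy S g q : G) = q.out⁻¹ * g * q.out := by
    intro g q h
    simp [cosetHolonomy, h, mul_assoc]
  have h_rev : ∀ e, ψ ((cover ω _).rev e) = -ψ e := by
    rintro ⟨q, d⟩
    simp only [hψ, cover_rev, ω.val_rev]
    rw [← ofMul_inv, EmbeddingLike.apply_eq_iff_eq, eq_inv_iff_mul_eq_one, mul_comm,
      ← cosetHolonomy_mul, mul_inv_cancel, cosetHolonomy_one]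
  have h_next : ∀ e, ψ e + ψ ((cover ω _).next e) + ψ ((cover ω _).next ((cover ω _).next e)) = 0 := by
    rintro ⟨q, d⟩
    simp only [hψ, cover_next]
    rw [← ofMul_mul, ← ofMul_mul, ← cosetHolonomy_mul, smul_smul, ← mul_inv_rev,
      ← cosetHolonomy_mul, ω.val_next, cosetHolonomy_one, ofMul_one]
  have h0 : ((lift ω ((1 : G) : G ⧸ Subgroup.zpowers S) s).map ψ).sum ≠ 0 := by
    rw [hsum, hS]
    intro h
    have h1 : cosetHolonomy S S ((1 : G) : G ⧸ Subgroup.zpowers S) = 1 := by simpa using h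
    have h2 := hval hfix
    rw [h1, OneMemClass.coe_one] at h2
    refine hS1 ?_
    have h3 : ∀ r : G, 1 = r⁻¹ * S * r → S = 1 := by
      intro r hr
      have : S = r * (r⁻¹ * S * r) * r⁻¹ := by group
      rw [this, ← hr]
      simp
    exact h3 _ h2
  obtain ⟨⟨q, y⟩, L, hL, hne, hle⟩ := exists_closed_mul_length_le ψ h_rev h_next
    (fun e => len e.2) (fun e => h_len e.2) _ hc h0 z k hk a ha hz
  obtain ⟨h1, h2, h3⟩ := eq_lift_of_isWalk hL
  rw [h2, hsum] at hne
  set l := L.map Prod.snd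
  have hmem := (cosetHolonomy S (ω.hol l) q).2
  have hv := hval h3
  refine ⟨y, l, h1, fun h => hne ?_, ?_, ?_⟩
  · simp [h, cosetHolonomy_one]
  · obtain ⟨n, hn⟩ := Subgroup.mem_zpowers_iff.1 hmem
    refine ⟨n, isConj_iff.2 ⟨q.out, ?_⟩⟩
    rw [hn, hv]
    group
  · simpa [l, Function.comp_def] using hle

variable {ω} in
lemma smul_coe_one_of_hol {s : List D} :
    (ω.hol s)⁻¹ • ((1 : G) : G ⧸ Subgroup.zpowers (ω.hol s)) = ((1 : G) : G ⧸ _) := by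
  rw [MulAction.Quotient.smul_coe, QuotientGroup.eq]
  simp

variable {ω} in
/-- A closed path homotopic to the `k`-th multiple of `s` is at least `k` times as long as some closed
path in a multiple of `s`. -/
lemma exists_conj_zpow_of_homotopic_power {s : List D} (hs : K.IsWalk v v s) (hS1 : ω.hol s ≠ 1)
    (len : D → ℝ) (h_len : ∀ d, 0 ≤ len d) (k : ℕ) (hk : 0 < k) {p : List D}
    (h : K.Homotopic x x l (p ++ power s k ++ K.inv p)) :
    ∃ y m, K.IsWalk y y m ∧ ω.hol m ≠ 1 ∧ (∃ n : ℤ, IsConj (ω.hol s ^ n) (ω.hol m)) ∧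
      k * (m.map len).sum ≤ (l.map len).sum := by
  set q₀ := ((1 : G) : G ⧸ Subgroup.zpowers (ω.hol s)) with hq₀
  obtain ⟨a, ha, hz⟩ := (h.lift (ω := ω) (ω.hol p • q₀)).homologous
  obtain ⟨y, m, h1, h2, h3, h4⟩ := exists_conj_zpow_mul_length_le hs rfl hS1 len h_len
    (lift ω (ω.hol p • q₀) l) k hk a ha (fun d => by
      have e1 : (ω.hol (power s k))⁻¹ • q₀ = q₀ := smul_hol_power smul_coe_one_of_hol k
      have e2 : lift ω q₀ (K.inv p) = (cover ω _).inv (lift ω (ω.hol p • q₀) p) := by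
        rw [inv_lift, inv_smul_smul]
      rw [hz, List.append_assoc, lift_append, inv_smul_smul, lift_append, e1, e2, chain_append,
        chain_append, chain_inv, chain_lift_power smul_coe_one_of_hol]
      ring)
  refine ⟨y, m, h1, h2, h3, h4.trans_eq ?_⟩
  conv_rhs => rw [← map_snd_lift (ω := ω) (q := ω.hol p • q₀) (l := l), List.map_map]
  rfl

/-- An essential closed path on an oriented surface has infinite order. -/
lemma hol_pow_ne_one {s : List D} (hs : K.IsWalk v v s) (hS1 : (K.treeHolonomy v).hol s ≠ 1)
    (k : ℕ) (hk : 0 < k) : (K.treeHolonomy v).hol s ^ k ≠ 1 := by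
  intro h
  rw [← Holonomy.hol_power] at h
  have h1 := homotopic_nil_of_hol_eq_one (hs.power k) h
  -- the empty path is a `k`-th multiple of `s`, and every dart has positive length
  obtain ⟨y, m, _, h2, _, h3⟩ := exists_conj_zpow_of_homotopic_power hs hS1 (fun _ => 1)
    (fun _ => zero_le_one) k hk (p := []) (l := []) (by simpa using h1.symm)
  refine h2 ?_
  have h4 : m = [] := by
    have hk' : (0 : ℝ) < k := by exact_mod_cast hk
    simp only [List.map_const', List.sum_replicate, nsmul_eq_mul, mul_one, List.length_nil,
      Nat.cast_zero] at h3
    have h5 : (m.length : ℝ) ≤ 0 := by nlinarith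
    exact List.length_eq_zero_iff.1 (by exact_mod_cast le_antisymm h5 (Nat.cast_nonneg _))
  rw [h4, Holonomy.hol_nil]

/-- Among the closed paths in the non-trivial multiples of an essential class `s`, one of smallest
length exists and lies in the class `s` itself, up to orientation. -/
theorem exists_shortest_closed [Finite D] {s : List D} (hs : K.IsWalk v v s)
    (h0 : ¬ K.Homotopic v v s []) (len : D → ℝ) (h_pos : ∀ d, 0 < len d) :
    ∃ x l p, K.IsWalk x v p ∧ (K.Homotopic x x l (p ++ s ++ K.inv p) ∨
        K.Homotopic x x l (p ++ K.inv s ++ K.inv p)) ∧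
      ∀ y m, K.IsWalk y y m → ∀ n : ℤ, n ≠ 0 →
        IsConj ((K.treeHolonomy v).hol s ^ n) ((K.treeHolonomy v).hol m) →
        (l.map len).sum ≤ (m.map len).sum := by
  set ω := K.treeHolonomy v with hω
  have h_len : ∀ d, 0 ≤ len d := fun d => (h_pos d).le
  have hS1 : ω.hol s ≠ 1 := fun h => h0 (homotopic_nil_of_hol_eq_one hs h)
  have htors : ∀ n : ℤ, n ≠ 0 → ω.hol s ^ n ≠ 1 := by
    intro n hn h
    refine hol_pow_ne_one hs hS1 n.natAbs (Int.natAbs_pos.2 hn) ?_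
    rcases Int.natAbs_eq n with h' | h'
    · rwa [h', zpow_natCast] at h
    · rwa [h', zpow_neg, zpow_natCast, inv_eq_one] at h
  set N : Set ℝ := {r | ∃ y m, K.IsWalk y y m ∧ ω.hol m ≠ 1 ∧
    (∃ n : ℤ, IsConj (ω.hol s ^ n) (ω.hol m)) ∧ (m.map len).sum = r} with hN
  -- lengths lie in a finitely generated additive monoid of non-negative numbers
  have hwf : N.IsWF := by
    have h1 : ((AddSubmonoid.closure (Set.range len) : AddSubmonoid ℝ) : Set ℝ).IsPWO := by
      refine Set.IsPWO.addSubmonoid_closure ?_ (Set.finite_range len).isPWO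
      rintro _ ⟨d, rfl⟩
      exact h_len d
    refine (h1.mono ?_).isWF
    rintro _ ⟨y, m, _, _, _, rfl⟩
    refine AddSubmonoid.list_sum_mem _ fun r hr => ?_
    obtain ⟨d, _, rfl⟩ := List.mem_map.1 hr
    exact AddSubmonoid.subset_closure ⟨d, rfl⟩
  have hne : N.Nonempty := ⟨_, v, s, hs, hS1, ⟨1, by rw [zpow_one]⟩, rfl⟩
  obtain ⟨x, l, hl, hl1, ⟨n, hn⟩, hlen⟩ := hwf.min_mem hne
  have hmin : ∀ y m, K.IsWalk y y m → ω.hol m ≠ 1 → (∃ n : ℤ, IsConj (ω.hol s ^ n) (ω.hol m)) →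
      (l.map len).sum ≤ (m.map len).sum := fun y m h1 h2 h3 =>
    hlen ▸ hwf.min_le hne ⟨y, m, h1, h2, h3, rfl⟩
  have hlpos : 0 < (l.map len).sum := by
    refine List.sum_pos _ (fun r hr => ?_) ?_
    · obtain ⟨d, _, rfl⟩ := List.mem_map.1 hr
      exact h_pos d
    · rw [Ne, List.map_eq_nil_iff]
      rintro rfl
      exact hl1 rfl
  -- with `e = s^±1`: if the shortest path is in the `k`-th multiple of `e`, then it is at least `k` times
  -- as long as itself
  have key : ∀ e : List D, K.IsWalk v v e → (∀ i : ℤ, ∃ j : ℤ, ω.hol e ^ i = ω.hol s ^ j) →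
      ω.hol e ≠ 1 → ∀ k : ℕ, 0 < k → IsConj (ω.hol e ^ k) (ω.hol l) →
      ∃ p, K.IsWalk x v p ∧ K.Homotopic x x l (p ++ e ++ K.inv p) := by
    intro e he hes he1 k hk hconj
    rw [← Holonomy.hol_power] at hconj
    obtain ⟨p, hp, hh⟩ := exists_homotopic_of_isConj hl (he.power k) hl1 hconj.symm
    obtain ⟨y, m, h1, h2, ⟨i, h3⟩, h4⟩ := exists_conj_zpow_of_homotopic_power (ω := ω) he he1 len
      h_len k hk hh
    obtain ⟨j, hj⟩ := hes i
    have h5 := hmin y m h1 h2 ⟨j, hj ▸ h3⟩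
    have hk1 : k = 1 := by
      by_contra hk1
      have h6 : (2 : ℝ) ≤ k := by exact_mod_cast (by omega : 2 ≤ k)
      nlinarith
    subst hk1
    exact ⟨p, hp, by simpa [power] using hh⟩
  refine ⟨x, l, ?_⟩
  have hn0 : n ≠ 0 := by
    rintro rfl
    exact hl1 (by simpa using hn.symm)
  have hmin' : ∀ y m, K.IsWalk y y m → ∀ n : ℤ, n ≠ 0 → IsConj (ω.hol s ^ n) (ω.hol m) →
      (l.map len).sum ≤ (m.map len).sum := by
    intro y m h1 n h2 h3
    refine hmin y m h1 (fun h => htors n h2 ?_) ⟨n, h3⟩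
    rw [h] at h3
    exact isConj_one_left.1 h3
  rcases Int.natAbs_eq n with h | h
  · rw [h, zpow_natCast] at hn
    obtain ⟨p, hp, hh⟩ := key s hs (fun i => ⟨i, rfl⟩) hS1 _ (Int.natAbs_pos.2 hn0) hn
    exact ⟨p, hp, Or.inl hh, hmin'⟩
  · rw [h, zpow_neg, zpow_natCast, ← inv_pow, ← Holonomy.hol_inv] at hn
    obtain ⟨p, hp, hh⟩ := key (K.inv s) hs.inv (fun i => ⟨-i, by simp⟩) (by simpa using hS1) _
      (Int.natAbs_pos.2 hn0) hn
    exact ⟨p, hp, Or.inr hh, hmin'⟩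

end Cyclic

end OrientedTriangulation

/-! ### The boundary as an oriented triangulated surface -/

/-- For a vertex `v` of a tetrahedron with orientation `ε`, the rotation of the three remaining labels,
for which `(v, f, rotate v f, rotate v (rotate v f))` has sign `ε`.  Bitwise, `Fin 4` is the Klein four
group; translations are even, and the rotation about `0` is conjugated by them. -/
def rotate (ε : ℤˣ) (v f : Fin 4) : Fin 4 :=
  v ^^^ (if ε = 1 then ![0, 2, 3, 1] else ![0, 3, 1, 2]) (v ^^^ f)

lemma rotate_ne_left (ε : ℤˣ) (v f : Fin 4) (h : v ≠ f) : v ≠ rotate ε v f := by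
  revert ε v f; decide

lemma rotate_ne_right (ε : ℤˣ) (v f : Fin 4) (h : v ≠ f) : rotate ε v f ≠ f := by
  revert ε v f; decide

@[simp] lemma rotate_rotate_rotate (ε : ℤˣ) (v f : Fin 4) :
    rotate ε v (rotate ε v (rotate ε v f)) = f := by
  revert ε v f; decide

lemma rotate_rotate_ne (ε : ℤˣ) (v f : Fin 4) (h : v ≠ f) : rotate ε v (rotate ε v f) ≠ f := by
  revert ε v f; decide

/-- A permutation of the labels that reverses orientation reverses the rotations. -/
lemma rotate_map (p : Equiv.Perm (Fin 4)) (ε : ℤˣ) (v f : Fin 4) :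
    rotate (-(Equiv.Perm.sign p) * ε) (p v) (p f) = p (rotate ε v (rotate ε v f)) := by
  revert p ε v f; decide

lemma eq_rotate (ε : ℤˣ) {v a b : Fin 4} (ha : v ≠ a) (hb : v ≠ b) :
    b = a ∨ b = rotate ε v a ∨ b = rotate ε v (rotate ε v a) := by
  revert ε v a b; decide

/-- A side of a boundary triangle.  Once orientations are chosen, it also stands for the edge directed
such that the triangle lies on its left. -/
@[ext]
structure TriangleSide (T : Type*) where
  t : T
  v : Fin 4
  f : Fin 4
  v_ne_f : v ≠ f

instance {T : Type*} [Finite T] : Finite (TriangleSide T) :=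
  Finite.of_injective (fun d => (d.t, d.v, d.f)) fun d e h => by
    simp only [Prod.mk.injEq] at h
    exact TriangleSide.ext h.1 h.2.1 h.2.2

namespace FaceGluing

variable {T : Type*} (M : FaceGluing T)

/-- Coherent orientations of the tetrahedra. -/
def IsOrientation (o : T → ℤˣ) : Prop :=
  ∀ t f, o (M.nbr t f) = -(Equiv.Perm.sign (M.glue t f)) * o t

variable {M} {o : T → ℤˣ} (ho : M.IsOrientation o)

lemma glue_symm_apply (t : T) (f i : Fin 4) :
    M.glue (M.nbr t f) (M.glue t f f) (M.glue t f i) = i := by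
  rw [M.glue_glue]
  exact (M.glue t f).symm_apply_apply i

lemma IsOrientation.rotate_glue (ho : M.IsOrientation o) (t : T) (f v a : Fin 4) :
    rotate (o (M.nbr t f)) (M.glue t f v) (M.glue t f a)
      = M.glue t f (rotate (o t) v (rotate (o t) v a)) := by
  rw [ho, rotate_map]

lemma directedEdge_glue {t : T} {f i j : Fin 4} (hi : i ≠ f) (hj : j ≠ f) :
    M.directedEdge (M.nbr t f) (M.glue t f i) (M.glue t f j) = M.directedEdge t i j :=
  (Quot.sound (EdgeStep.mk t f i j hi hj)).symm

lemma boundaryEdge_glue {t : T} {v f : Fin 4} (h : v ≠ f) :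
    M.boundaryEdge (M.nbr t f) (M.glue t f v) (M.glue t f f) = M.boundaryEdge t v f :=
  (Quot.sound (SideStep.mk t v f h)).symm

/-- The triangulated boundary of an oriented ideal triangulation. -/
def boundarySurface (ho : M.IsOrientation o) :
    OrientedTriangulation (TriangleSide T) M.DirectedEdge where
  src d := M.directedEdge d.t d.v (rotate (o d.t) d.v d.f)
  rev d := ⟨M.nbr d.t d.f, M.glue d.t d.f d.v, M.glue d.t d.f d.f,
    (M.glue d.t d.f).injective.ne d.v_ne_f⟩
  next d := ⟨d.t, d.v, rotate (o d.t) d.v d.f, rotate_ne_left _ _ _ d.v_ne_f⟩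
  rev_rev d := by
    ext1
    · exact M.nbr_nbr _ _
    · simp only [M.glue_symm_apply]
    · simp only [M.glue_symm_apply]
  rev_ne d h := by
    have h1 := congrArg TriangleSide.t h
    have h2 := congrArg TriangleSide.f h
    exact M.not_self_glued _ _ ⟨h1, h2⟩
  next_next_next d := by simp
  next_ne d h := rotate_ne_right _ _ _ d.v_ne_f (congrArg TriangleSide.f h)
  src_next d := by
    simp only [ho.rotate_glue]
    rw [directedEdge_glue d.v_ne_f (rotate_rotate_ne _ _ _ d.v_ne_f)]

@[simp] lemma boundarySurface_src (d : TriangleSide T) :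
    (boundarySurface ho).src d = M.directedEdge d.t d.v (rotate (o d.t) d.v d.f) := rfl

@[simp] lemma boundarySurface_tgt (d : TriangleSide T) :
    (boundarySurface ho).tgt d
      = M.directedEdge d.t d.v (rotate (o d.t) d.v (rotate (o d.t) d.v d.f)) :=
  ((boundarySurface ho).src_next' d).symm

lemma boundarySurface_next (d : TriangleSide T) : (boundarySurface ho).next d
    = ⟨d.t, d.v, rotate (o d.t) d.v d.f, rotate_ne_left _ _ _ d.v_ne_f⟩ := rfl

/-- The side of the triangle `(t, v)` from the corner `a` to the corner `b`, as a path (which is empty if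
these corners agree). -/
def cornerPath (t : T) (v a b : Fin 4) (ha : v ≠ a) (hb : v ≠ b) : List (TriangleSide T) :=
  if a = b then []
  else if b = rotate (o t) v a then [⟨t, v, rotate (o t) v b, rotate_ne_left _ _ _ hb⟩]
  else [(boundarySurface ho).rev ⟨t, v, rotate (o t) v a, rotate_ne_left _ _ _ ha⟩]

variable {t : T} {v a b c : Fin 4}

@[simp] lemma cornerPath_self (ha : v ≠ a) (hb : v ≠ a) : cornerPath ho t v a a ha hb = [] := by
  simp [cornerPath]

lemma cornerPath_rotate (ha : v ≠ a) (hb : v ≠ rotate (o t) v a) :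
    cornerPath ho t v a (rotate (o t) v a) ha hb
      = [⟨t, v, rotate (o t) v (rotate (o t) v a), rotate_ne_left _ _ _ hb⟩] := by
  rw [cornerPath, if_neg (rotate_ne_right _ _ _ ha).symm, if_pos rfl]

lemma cornerPath_rotate_rotate (ha : v ≠ a) (hb : v ≠ rotate (o t) v (rotate (o t) v a)) :
    cornerPath ho t v a (rotate (o t) v (rotate (o t) v a)) ha hb
      = [(boundarySurface ho).rev ⟨t, v, rotate (o t) v a, rotate_ne_left _ _ _ ha⟩] := by
  rw [cornerPath, if_neg (rotate_rotate_ne _ _ _ ha).symm,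
    if_neg (rotate_ne_right _ _ _ (rotate_ne_left _ _ _ ha))]

lemma isWalk_cornerPath (ha : v ≠ a) (hb : v ≠ b) :
    (boundarySurface ho).IsWalk (M.directedEdge t v a) (M.directedEdge t v b)
      (cornerPath ho t v a b ha hb) := by
  rcases eq_rotate (o t) ha hb with rfl | rfl | rfl
  · simp
  · rw [cornerPath_rotate]
    exact ⟨by simp, by simp⟩
  · rw [cornerPath_rotate_rotate]
    refine ⟨?_, ?_⟩
    · rw [OrientedTriangulation.src_rev]
      simp
    · simp

lemma inv_cornerPath (ha : v ≠ a) (hb : v ≠ b) :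
    (boundarySurface ho).inv (cornerPath ho t v a b ha hb) = cornerPath ho t v b a hb ha := by
  rcases eq_rotate (o t) ha hb with rfl | rfl | rfl
  · simp
  · have := cornerPath_rotate_rotate ho (t := t) (v := v) (a := rotate (o t) v a) hb (by simpa)
    simp only [rotate_rotate_rotate] at this
    rw [cornerPath_rotate, this]
    simp
  · have := cornerPath_rotate ho (t := t) (v := v)
      (a := rotate (o t) v (rotate (o t) v a)) hb (by simpa)
    simp only [rotate_rotate_rotate] at this
    rw [cornerPath_rotate_rotate, this]
    simp [OrientedTriangulation.rev_rev]

/-- The triangles on the two sides of an edge give the same path along it. -/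
lemma cornerPath_glue {f : Fin 4} (hf : v ≠ f) (ha : v ≠ a) (hb : v ≠ b) (haf : a ≠ f) (hbf : b ≠ f)
    (ha' : M.glue t f v ≠ M.glue t f a) (hb' : M.glue t f v ≠ M.glue t f b) :
    cornerPath ho (M.nbr t f) (M.glue t f v) (M.glue t f a) (M.glue t f b) ha' hb'
      = cornerPath ho t v a b ha hb := by
  -- it suffices to treat one direction, by reversal
  have key : ∀ (a : Fin 4) (ha : v ≠ a) (hr : v ≠ rotate (o t) v a)
      (ha' : M.glue t f v ≠ M.glue t f a) (hr' : M.glue t f v ≠ M.glue t f (rotate (o t) v a)),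
      a ≠ f → rotate (o t) v a ≠ f →
      cornerPath ho (M.nbr t f) (M.glue t f v) (M.glue t f a) (M.glue t f (rotate (o t) v a)) ha' hr'
        = cornerPath ho t v a (rotate (o t) v a) ha hr := by
    intro a ha hr ha' hr' haf hrf
    have e1 : M.glue t f (rotate (o t) v a) = rotate (o (M.nbr t f)) (M.glue t f v)
        (rotate (o (M.nbr t f)) (M.glue t f v) (M.glue t f a)) := by
      rw [ho.rotate_glue, ho.rotate_glue]
      simp
    have e2 : f = rotate (o t) v (rotate (o t) v a) := by
      rcases eq_rotate (o t) ha hf with h | h | h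
      · exact absurd h.symm haf
      · exact absurd h.symm hrf
      · exact h
    have e3 : ∀ (c : Fin 4) (hc : M.glue t f v ≠ c), c = rotate (o (M.nbr t f)) (M.glue t f v)
        (rotate (o (M.nbr t f)) (M.glue t f v) (M.glue t f a)) →
        cornerPath ho (M.nbr t f) (M.glue t f v) (M.glue t f a) c ha' hc
        = [(boundarySurface ho).rev ⟨M.nbr t f, M.glue t f v,
            rotate (o (M.nbr t f)) (M.glue t f v) (M.glue t f a), rotate_ne_left _ _ _ ha'⟩] := by
      rintro c hc rfl
      exact cornerPath_rotate_rotate ho ha' hc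
    rw [e3 _ _ e1, cornerPath_rotate]
    have e4 : (⟨t, v, rotate (o t) v (rotate (o t) v a), rotate_ne_left _ _ _ hr⟩ :
        TriangleSide T) = ⟨t, v, f, hf⟩ := by
      ext1
      · rfl
      · rfl
      · exact e2.symm
    rw [e4, ← (boundarySurface ho).rev_rev ⟨t, v, f, hf⟩]
    congr 2
    ext1
    · rfl
    · rfl
    · simp only [boundarySurface]
      rw [ho.rotate_glue, ← e2]
  rcases eq_rotate (o t) ha hb with rfl | rfl | rfl
  · simp
  · exact key a ha hb ha' hb' haf hbf
  · rw [← inv_cornerPath ho hb' ha', ← inv_cornerPath ho hb ha]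
    have := key (rotate (o t) v (rotate (o t) v a)) hb (by simpa) hb' (by simpa) hbf (by simpa)
    simp only [rotate_rotate_rotate] at this
    rw [this]

end FaceGluing

namespace FaceGluing

variable {T : Type*} {M : FaceGluing T} {o : T → ℤˣ} (ho : M.IsOrientation o)
  {t : T} {v a b c : Fin 4}

section

variable {G : Type*} [Group G] (ω : (boundarySurface ho).Holonomy G)

lemma hol_cornerPath_mul (ha : v ≠ a) (hb : v ≠ b) (hc : v ≠ c) :
    ω.hol (cornerPath ho t v a b ha hb) * ω.hol (cornerPath ho t v b c hb hc)
      = ω.hol (cornerPath ho t v a c ha hc) := by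
  have hω := ω.val_next ⟨t, v, a, ha⟩
  simp only [boundarySurface] at hω
  rcases eq_rotate (o t) ha hb with rfl | rfl | rfl
  · simp
  · rcases eq_rotate (o t) hb hc with rfl | rfl | rfl
    · simp
    · rw [cornerPath_rotate, cornerPath_rotate, cornerPath_rotate_rotate]
      simp only [OrientedTriangulation.Holonomy.hol_cons, OrientedTriangulation.Holonomy.hol_nil,
        mul_one, ω.val_rev, rotate_rotate_rotate]
      rw [eq_inv_iff_mul_eq_one, ← mul_eq_one_iff_inv_eq.1 hω]
      group
    · rw [cornerPath_rotate, cornerPath_rotate_rotate]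
      simp [ω.val_rev]
  · rcases eq_rotate (o t) hb hc with rfl | rfl | rfl
    · simp
    · rw [cornerPath_rotate_rotate, cornerPath_rotate]
      simp [ω.val_rev]
    · rw [cornerPath_rotate_rotate, cornerPath_rotate_rotate]
      simp only [rotate_rotate_rotate]
      rw [cornerPath_rotate]
      simp only [OrientedTriangulation.Holonomy.hol_cons, OrientedTriangulation.Holonomy.hol_nil,
        mul_one, ω.val_rev]
      rw [← mul_eq_one_iff_inv_eq.1 hω, mul_inv_rev]

end

/-! ### Edge paths of the cell structure -/

variable (M) in
/-- `w` is an edge path from `x` to `y` in the cell structure on the boundary. -/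
def IsPath : M.Node → M.Node → Word T → Prop
  | x, y, [] => x = y
  | x, y, l :: w => M.src l = x ∧ IsPath (M.tgt l) y w

variable {x y z : M.Node} {u w : Word T}

@[simp] lemma isPath_nil : M.IsPath x y [] ↔ x = y := Iff.rfl

@[simp] lemma isPath_cons {l : Arc T × Bool} :
    M.IsPath x y (l :: w) ↔ M.src l = x ∧ M.IsPath (M.tgt l) y w := Iff.rfl

lemma isPath_append : M.IsPath x y (u ++ w) ↔ ∃ z, M.IsPath x z u ∧ M.IsPath z y w := by
  induction u generalizing x with
  | nil => simp
  | cons d l ih => simp [ih, and_assoc]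

lemma IsPath.append (h : M.IsPath x y u) (h' : M.IsPath y z w) : M.IsPath x z (u ++ w) :=
  isPath_append.2 ⟨y, h, h'⟩

lemma isClosedWalk_iff [Nonempty M.Node] : M.IsClosedWalk w ↔ ∃ x, M.IsPath x x w := by
  have key : ∀ (w : Word T) (l z : Arc T × Bool),
      (l :: w ++ [z]).IsChain (fun a b => M.tgt a = M.src b) ↔
        M.IsPath (M.src l) (M.src z) (l :: w) := by
    intro w
    induction w with
    | nil => simp
    | cons m w ih =>
      intro l z
      rw [List.cons_append, List.cons_append, List.isChain_cons_cons, ← List.cons_append, ih m z]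
      simp only [isPath_cons, true_and]
      constructor
      · rintro ⟨h1, h2⟩
        exact ⟨h1.symm, h2⟩
      · rintro ⟨h1, h2⟩
        exact ⟨h1.symm, h2⟩
  cases w with
  | nil => simp [IsClosedWalk]
  | cons l w =>
    rw [IsClosedWalk, List.head?_cons, Option.toList_some, key]
    constructor
    · exact fun h => ⟨_, h⟩
    · rintro ⟨x, h⟩
      obtain rfl := h.1
      exact h

@[simp] lemma src_not (l : Arc T × Bool) : M.src (l.1, !l.2) = M.tgt l := by
  rcases l with ⟨a, _ | _⟩ <;> simp [src, tgt]

@[simp] lemma tgt_not (l : Arc T × Bool) : M.tgt (l.1, !l.2) = M.src l := by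
  rcases l with ⟨a, _ | _⟩ <;> simp [src, tgt]

@[simp] lemma reverse_nil : Word.reverse ([] : Word T) = [] := rfl

@[simp] lemma reverse_cons (l : Arc T × Bool) :
    Word.reverse (l :: w) = Word.reverse w ++ [(l.1, !l.2)] := by simp [Word.reverse]

@[simp] lemma reverse_append : Word.reverse (u ++ w) = Word.reverse w ++ Word.reverse u := by
  simp [Word.reverse]

@[simp] lemma reverse_reverse : Word.reverse (Word.reverse w) = w := by
  induction w with
  | nil => rfl
  | cons d l ih => simp [ih]

lemma IsPath.reverse (h : M.IsPath x y w) : M.IsPath y x (Word.reverse w) := by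
  induction w generalizing x with
  | nil => exact Eq.symm h
  | cons d l ih =>
    rw [reverse_cons]
    exact (ih h.2).append ⟨by simp, by simpa using h.1⟩

/-! ### Projection to the 1-skeleton -/

open Classical in
/-- A chosen end of the edge of the boundary on which the given side lies, as a corner of the triangle.
The choice, by means of a well-ordering, is the same in the two triangles adjacent to the edge. -/
noncomputable def midCorner (d : TriangleSide T) : Fin 4 :=
  if WellOrderingRel d ((boundarySurface ho).rev d) then rotate (o d.t) d.v d.f
  else rotate (o d.t) d.v (rotate (o d.t) d.v d.f)

lemma midCorner_ne_v (d : TriangleSide T) : d.v ≠ midCorner ho d := by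
  have h := rotate_ne_left (o d.t) _ _ d.v_ne_f
  rw [midCorner]
  split_ifs
  · exact h
  · exact rotate_ne_left _ _ _ h

lemma midCorner_ne_f (d : TriangleSide T) : midCorner ho d ≠ d.f := by
  rw [midCorner]
  split_ifs
  · exact rotate_ne_right _ _ _ d.v_ne_f
  · exact rotate_rotate_ne _ _ _ d.v_ne_f

lemma midCorner_rev (d : TriangleSide T) :
    midCorner ho ((boundarySurface ho).rev d) = M.glue d.t d.f (midCorner ho d) := by
  have h1 : rotate (o (M.nbr d.t d.f)) (M.glue d.t d.f d.v) (M.glue d.t d.f d.f)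
    = M.glue d.t d.f (rotate (o d.t) d.v (rotate (o d.t) d.v d.f)) := ho.rotate_glue _ _ _ _
  by_cases h : WellOrderingRel d ((boundarySurface ho).rev d)
  · have h' : ¬ WellOrderingRel ((boundarySurface ho).rev d) d := fun h' => asymm h h'
    rw [midCorner, midCorner, (boundarySurface ho).rev_rev, if_pos h, if_neg h']
    simp only [boundarySurface]
    rw [h1, ho.rotate_glue]
    simp
  · have h' : WellOrderingRel ((boundarySurface ho).rev d) d :=
      (trichotomous_of WellOrderingRel d ((boundarySurface ho).rev d)).resolve_left h |>.resolve_left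
        ((boundarySurface ho).rev_ne d).symm
    rw [midCorner, midCorner, (boundarySurface ho).rev_rev, if_neg h, if_pos h']
    exact h1

lemma ne_succ (v : Fin 4) : v ≠ v + 1 := by revert v; decide

/-- The projection of a 1-cell to the 1-skeleton.  It moves the centre of the triangle `(t, v)` to its
corner `v + 1`, and the midpoints of edges to their chosen ends. -/
noncomputable def projArc : Arc T → List (TriangleSide T)
  | .spoke t v f h => cornerPath ho t v (v + 1) (midCorner ho ⟨t, v, f, h⟩) (ne_succ v)
      (midCorner_ne_v ho ⟨t, v, f, h⟩)
  | .half t v f w h => cornerPath ho t v w (midCorner ho ⟨t, v, f, by simp_all⟩) (by simp_all)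
      (midCorner_ne_v ho ⟨t, v, f, by simp_all⟩)

/-- The projection of a 1-cell traversed in either direction. -/
noncomputable def projLetter (l : Arc T × Bool) : List (TriangleSide T) :=
  if l.2 then projArc ho l.1 else (boundarySurface ho).inv (projArc ho l.1)

/-- The projection of edge paths of the cell structure to the 1-skeleton. -/
noncomputable def proj (w : Word T) : List (TriangleSide T) := w.flatMap (projLetter ho)

@[simp] lemma proj_nil : proj ho [] = [] := rfl

@[simp] lemma proj_cons (l : Arc T × Bool) : proj ho (l :: w) = projLetter ho l ++ proj ho w := by
  simp [proj]

@[simp] lemma proj_append : proj ho (u ++ w) = proj ho u ++ proj ho w := by simp [proj]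

lemma projLetter_not (l : Arc T × Bool) :
    projLetter ho (l.1, !l.2) = (boundarySurface ho).inv (projLetter ho l) := by
  rcases l with ⟨a, _ | _⟩ <;> simp [projLetter]

lemma proj_reverse : proj ho (Word.reverse w) = (boundarySurface ho).inv (proj ho w) := by
  induction w with
  | nil => rfl
  | cons d l ih => simp [ih, projLetter_not]

/-- The vertices to which the vertices of the cell structure are moved.  (Triples `(t, v, v)` do not stand for
sides of triangles, and their images are irrelevant.) -/
noncomputable def projNode : M.Node → M.DirectedEdge
  | .centre t v => M.directedEdge t v (v + 1)
  | .vertex p => p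
  | .mid e => Quot.lift (fun d : T × Fin 4 × Fin 4 => if h : d.2.1 ≠ d.2.2 then
        M.directedEdge d.1 d.2.1 (midCorner ho ⟨d.1, d.2.1, d.2.2, h⟩)
      else M.directedEdge d.1 d.2.1 d.2.1) (by
    rintro _ _ ⟨t, v, f, h⟩
    have h' : M.glue t f v ≠ M.glue t f f := (M.glue t f).injective.ne h
    simp only [dif_pos h, dif_pos h', ne_eq]
    have := midCorner_rev ho ⟨t, v, f, h⟩
    simp only [boundarySurface] at this
    rw [this, directedEdge_glue h (midCorner_ne_f ho ⟨t, v, f, h⟩)]) e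

lemma isWalk_projArc (a : Arc T) : (boundarySurface ho).IsWalk (projNode ho (M.arcSrc a))
    (projNode ho (M.arcTgt a)) (projArc ho a) := by
  cases a with
  | spoke t v f h =>
    simp only [arcSrc, arcTgt, projNode, boundaryEdge, ne_eq, h, not_false_eq_true, dite_true]
    exact isWalk_cornerPath ho (ne_succ v) (midCorner_ne_v ho ⟨t, v, f, h⟩)
  | half t v f w h =>
    have h' : v ≠ f := by simp_all
    simp only [arcSrc, arcTgt, projNode, boundaryEdge, ne_eq, h', not_false_eq_true, dite_true]
    exact isWalk_cornerPath ho (by simp_all) (midCorner_ne_v ho ⟨t, v, f, h'⟩)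

lemma isWalk_projLetter (l : Arc T × Bool) : (boundarySurface ho).IsWalk
    (projNode ho (M.src l)) (projNode ho (M.tgt l)) (projLetter ho l) := by
  rcases l with ⟨a, _ | _⟩
  · exact (isWalk_projArc ho a).inv
  · exact isWalk_projArc ho a

lemma IsPath.proj (h : M.IsPath x y w) :
    (boundarySurface ho).IsWalk (projNode ho x) (projNode ho y) (proj ho w) := by
  induction w generalizing x with
  | nil =>
    obtain rfl : x = y := h
    simp
  | cons l w ih =>
    obtain ⟨rfl, h⟩ := h
    rw [proj_cons]
    exact (isWalk_projLetter ho l).append (ih h)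

section

variable {G : Type*} [Group G] (ω : (boundarySurface ho).Holonomy G)

lemma hol_proj_cell {r : Word T} (h : M.IsCell r) : ω.hol (proj ho r) = 1 := by
  cases h with
  | quad t v f g w hf hg hfw hgw hfg =>
    simp only [proj_cons, projLetter, projArc, inv_cornerPath, proj_nil, List.append_nil,
      OrientedTriangulation.Holonomy.hol_append, if_true, Bool.false_eq_true, if_false]
    rw [← mul_assoc, hol_cornerPath_mul, ← mul_assoc, hol_cornerPath_mul, hol_cornerPath_mul]
    simp
  | bigon t v f w h h' =>
    have hf : v ≠ f := by simp_all
    have hw : v ≠ w := by simp_all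
    have hwf : w ≠ f := by rintro rfl; simp_all
    have hm := midCorner_rev ho ⟨t, v, f, hf⟩
    simp only [boundarySurface] at hm
    simp only [proj_cons, projLetter, projArc, inv_cornerPath, proj_nil, List.append_nil,
      OrientedTriangulation.Holonomy.hol_append, if_true, Bool.false_eq_true, if_false]
    have := cornerPath_glue ho (t := t) (b := w) hf (midCorner_ne_v ho ⟨t, v, f, hf⟩) hw
      (midCorner_ne_f ho ⟨t, v, f, hf⟩) hwf
      ((M.glue t f).injective.ne (midCorner_ne_v ho ⟨t, v, f, hf⟩))
      ((M.glue t f).injective.ne hw)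
    simp only [hm]
    rw [this, hol_cornerPath_mul]
    simp

/-- Freely homotopic curves have conjugate holonomies. -/
lemma FreelyHomotopic.isConj (h : M.FreelyHomotopic u w) :
    IsConj (ω.hol (proj ho u)) (ω.hol (proj ho w)) := by
  induction h with
  | refl => exact IsConj.refl _
  | symm _ ih => exact ih.symm
  | trans _ _ ih ih' => exact ih.trans ih'
  | rotate u w _ =>
    simp only [proj_append, OrientedTriangulation.Holonomy.hol_append]
    exact isConj_iff.2 ⟨(ω.hol (proj ho u))⁻¹, by group⟩
  | cancel a b w _ =>
    have := projLetter_not ho (a, b)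
    simp only at this
    have e : ω.hol (proj ho ((a, b) :: (a, !b) :: w)) = ω.hol (proj ho w) := by simp [this]
    rw [e]
  | cell r w hr _ =>
    have e : ω.hol (proj ho (r ++ w)) = ω.hol (proj ho w) := by simp [hol_proj_cell ho ω hr]
    rw [e]

lemma hol_proj_power (k : ℕ) : ω.hol (proj ho (Word.power w k)) = ω.hol (proj ho w) ^ k := by
  induction k with
  | zero => simp [Word.power]
  | succ k ih =>
    have : Word.power w (k + 1) = w ++ Word.power w k := by simp [Word.power, List.replicate_succ]
    rw [this, proj_append, OrientedTriangulation.Holonomy.hol_append, ih, pow_succ']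

lemma HasMultipleClass.isConj {s : M.ClosedCurve} (h : M.HasMultipleClass w s) :
    ∃ n : ℤ, n ≠ 0 ∧ IsConj (ω.hol (proj ho s.word) ^ n) (ω.hol (proj ho w)) := by
  obtain ⟨k, hk, h | h⟩ := h
  · refine ⟨k, by omega, ?_⟩
    have := (h.isConj ho ω).symm
    rwa [hol_proj_power, ← zpow_natCast] at this
  · refine ⟨-k, by omega, ?_⟩
    have := (h.isConj ho ω).symm
    rwa [hol_proj_power, proj_reverse, OrientedTriangulation.Holonomy.hol_inv, inv_pow,
      ← zpow_natCast, ← zpow_neg] at this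

lemma HasClass.isConj {s : M.ClosedCurve} (h : M.HasClass w s) :
    ∃ n : ℤ, n ≠ 0 ∧ IsConj (ω.hol (proj ho s.word) ^ n) (ω.hol (proj ho w)) :=
  HasMultipleClass.isConj ho ω ⟨1, one_pos, by simpa [Word.power, HasClass] using h⟩

end

end FaceGluing

namespace FaceGluing

variable {T : Type*} {M : FaceGluing T} {o : T → ℤˣ} (ho : M.IsOrientation o)
  {x y z : M.Node} {u u' w w' r : Word T}

/-! ### Homotopy of paths in the cell structure -/

lemma IsPath.isClosedWalk (h : M.IsPath x x w) : M.IsClosedWalk w :=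
  haveI : Nonempty M.Node := ⟨x⟩
  isClosedWalk_iff.2 ⟨x, h⟩

variable (M) in
/-- Paths with the same ends that can be replaced by each other in closed paths, without changing the
free homotopy class. -/
def PathEquiv (x y : M.Node) (u w : Word T) : Prop :=
  M.IsPath x y u ∧ M.IsPath x y w ∧
    ∀ r, M.IsPath y x r → M.FreelyHomotopic (u ++ r) (w ++ r)

namespace PathEquiv

lemma refl (h : M.IsPath x y u) : M.PathEquiv x y u u := ⟨h, h, fun _ _ => .refl _⟩

lemma symm (h : M.PathEquiv x y u w) : M.PathEquiv x y w u :=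
  ⟨h.2.1, h.1, fun r hr => (h.2.2 r hr).symm⟩

lemma trans (h : M.PathEquiv x y u w) (h' : M.PathEquiv x y w r) : M.PathEquiv x y u r :=
  ⟨h.1, h'.2.1, fun q hq => (h.2.2 q hq).trans (h'.2.2 q hq)⟩

lemma freelyHomotopic (h : M.PathEquiv x x u w) : M.FreelyHomotopic u w := by
  simpa using h.2.2 [] rfl

lemma append_right (h : M.PathEquiv x y u w) (hr : M.IsPath y z r) :
    M.PathEquiv x z (u ++ r) (w ++ r) :=
  ⟨h.1.append hr, h.2.1.append hr, fun q hq => by simpa using h.2.2 (r ++ q) (hr.append hq)⟩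

lemma append_left (hr : M.IsPath z x r) (h : M.PathEquiv x y u w) :
    M.PathEquiv z y (r ++ u) (r ++ w) := by
  refine ⟨hr.append h.1, hr.append h.2.1, fun q hq => ?_⟩
  have h1 := FreelyHomotopic.rotate r (u ++ q) (hr.append (h.1.append hq)).isClosedWalk
  have h2 := FreelyHomotopic.rotate r (w ++ q) (hr.append (h.2.1.append hq)).isClosedWalk
  have h3 := h.2.2 (q ++ r) (hq.append hr)
  simp only [List.append_assoc] at *
  exact (h1.trans h3).trans h2.symm

lemma append (h : M.PathEquiv x y u w) (h' : M.PathEquiv y z u' w') :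
    M.PathEquiv x z (u ++ u') (w ++ w') :=
  (h.append_right h'.1).trans (append_left h.2.1 h')

lemma cell (hr : M.IsCell r) (h : M.IsPath x x r) : M.PathEquiv x x r [] :=
  ⟨h, rfl, fun q hq => .cell r q hr (h.append hq).isClosedWalk⟩

lemma append_reverse (h : M.IsPath x y u) : M.PathEquiv x x (u ++ Word.reverse u) [] := by
  induction u generalizing x with
  | nil => exact refl rfl
  | cons l u ih =>
    have hl : M.IsPath x (M.tgt l) [l] := ⟨h.1, rfl⟩
    have h1 := ((ih h.2).append_right hl.reverse)
    have h2 := append_left hl h1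
    have h3 : M.PathEquiv x x [l, (l.1, !l.2)] [] :=
      ⟨by simp [h.1], rfl, fun q hq =>
        .cancel l.1 l.2 q (IsPath.isClosedWalk (x := x) ⟨h.1, by simp, by simpa [h.1] using hq⟩)⟩
    simpa using h2.trans (by simpa using h3)

lemma reverse_append (h : M.IsPath x y u) : M.PathEquiv y y (Word.reverse u ++ u) [] := by
  simpa using append_reverse h.reverse

lemma reverse (h : M.PathEquiv x y u w) : M.PathEquiv y x (Word.reverse u) (Word.reverse w) := by
  have h1 := append_left h.1.reverse (append_reverse h.2.1).symm
  have h2 := (append_left h.1.reverse h.symm).append_right h.2.1.reverse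
  have h3 := (reverse_append h.1).append_right h.2.1.reverse
  simpa using (h1.trans (by simpa using h2)).trans h3

/-- `u w⁻¹ ≃ 1` means `u ≃ w`. -/
lemma of_append_reverse (hw : M.IsPath x y w) (h : M.PathEquiv x x (u ++ Word.reverse w) [])
    (hu : M.IsPath x y u) : M.PathEquiv x y u w := by
  have h1 := append_left hu (reverse_append hw).symm
  have h2 := h.append_right hw
  simpa using h1.trans (by simpa using h2)

/-- Three paths that factor through a common point, around a triangle. -/
lemma triangle {c x₀ x₁ x₂ : M.Node} {A₀ A₁ A₂ u₀ u₁ u₂ : Word T} (h₀ : M.IsPath c x₀ A₀)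
    (h₁ : M.IsPath c x₁ A₁) (h₂ : M.IsPath c x₂ A₂)
    (e₀ : M.PathEquiv x₁ x₂ u₀ (Word.reverse A₁ ++ A₂))
    (e₁ : M.PathEquiv x₂ x₀ u₁ (Word.reverse A₂ ++ A₀))
    (e₂ : M.PathEquiv x₀ x₁ u₂ (Word.reverse A₀ ++ A₁)) :
    M.PathEquiv x₁ x₁ (u₀ ++ (u₁ ++ u₂)) [] := by
  refine (e₀.append (e₁.append e₂)).trans ?_
  have s₁ := ((append_reverse h₀).append_left h₂.reverse).append_right h₁
  have s₂ := ((append_reverse h₂).append_left h₁.reverse).append_right h₁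
  have s₃ := s₁.append_left (h₁.reverse.append h₂)
  simp only [List.append_assoc, List.append_nil] at *
  exact (s₃.trans s₂).trans (reverse_append h₁)

end PathEquiv

/-! ### Realizing simplicial paths in the cell structure -/

/-- The directed side that corresponds to a side of a triangle, in an oriented surface. -/
def toDirectedSide (o : T → ℤˣ) (d : TriangleSide T) : DirectedSide T where
  t := d.t
  v := d.v
  f := d.f
  a := rotate (o d.t) d.v d.f
  b := rotate (o d.t) d.v (rotate (o d.t) d.v d.f)
  distinct_a := by
    have h1 := rotate_ne_left (o d.t) _ _ d.v_ne_f
    have h2 := (rotate_ne_right (o d.t) _ _ d.v_ne_f).symm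
    have h3 := d.v_ne_f
    simp [h1, h2, h3]
  distinct_b := by
    have h1 := rotate_ne_left (o d.t) _ _ (rotate_ne_left (o d.t) _ _ d.v_ne_f)
    have h2 := (rotate_rotate_ne (o d.t) _ _ d.v_ne_f).symm
    have h3 := d.v_ne_f
    simp [h1, h2, h3]
  a_ne_b := (rotate_ne_right (o d.t) _ _ (rotate_ne_left (o d.t) _ _ d.v_ne_f)).symm

/-- A simplicial path as a path in the cell structure. -/
def realize (o : T → ℤˣ) (l : List (TriangleSide T)) : Word T :=
  (l.map (toDirectedSide o)).flatMap DirectedSide.path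

@[simp] lemma realize_nil : realize o ([] : List (TriangleSide T)) = [] := rfl

lemma realize_cons (d : TriangleSide T) (l : List (TriangleSide T)) :
    realize o (d :: l) = realize o [d] ++ realize o l := by
  simp [realize]

lemma realize_append (l m : List (TriangleSide T)) :
    realize o (l ++ m) = realize o l ++ realize o m := by
  simp [realize]

lemma isPath_realize_singleton (d : TriangleSide T) :
    M.IsPath (.vertex ((boundarySurface ho).src d)) (.vertex ((boundarySurface ho).tgt d))
      (realize o [d]) := by
  simp [realize, DirectedSide.path, toDirectedSide, src, tgt, arcSrc, arcTgt]

lemma isPath_realize {p q : M.DirectedEdge} {l : List (TriangleSide T)}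
    (h : (boundarySurface ho).IsWalk p q l) : M.IsPath (.vertex p) (.vertex q) (realize o l) := by
  induction l generalizing p with
  | nil =>
    obtain rfl : p = q := h
    simp
  | cons d l ih =>
    obtain ⟨rfl, h⟩ := h
    rw [realize_cons]
    exact (isPath_realize_singleton ho d).append (ih h)

variable {t : T} {v f g a b : Fin 4}

/-- The path from the centre of a triangle to its corner `a` by way of the midpoint of the side `f`. -/
def centreToCorner (t : T) (v f a : Fin 4) (h : [v, f, a].Nodup) : Word T :=
  [(.spoke t v f (by simp_all), true), (.half t v f a h, false)]

lemma isPath_centreToCorner (h : [v, f, a].Nodup) :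
    M.IsPath (.centre t v) (.vertex (M.directedEdge t v a)) (centreToCorner t v f a h) := by
  simp [centreToCorner, src, tgt, arcSrc, arcTgt]

lemma centreToCorner_equiv (hf : [v, f, a].Nodup) (hg : [v, g, a].Nodup) :
    M.PathEquiv (.centre t v) (.vertex (M.directedEdge t v a)) (centreToCorner t v f a hf)
      (centreToCorner t v g a hg) := by
  by_cases hfg : f = g
  · subst hfg
    exact .refl (isPath_centreToCorner hf)
  refine .of_append_reverse (isPath_centreToCorner hg) ?_ (isPath_centreToCorner hf)
  refine .cell ?_ ((isPath_centreToCorner hf).append (isPath_centreToCorner hg).reverse)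
  have := IsCell.quad (M := M) t v f g a (by simp_all) (by simp_all) hf hg hfg
  simpa [centreToCorner, Word.reverse] using this

lemma isPath_half (h : [v, f, a].Nodup) :
    M.IsPath (.vertex (M.directedEdge t v a)) (.mid (M.boundaryEdge t v f))
      [(.half t v f a h, true)] := by
  simp [src, tgt, arcSrc, arcTgt]

lemma half_equiv_glue (h : [v, f, a].Nodup)
    (h' : [M.glue t f v, M.glue t f f, M.glue t f a].Nodup) :
    M.PathEquiv (.vertex (M.directedEdge t v a)) (.mid (M.boundaryEdge t v f))
      [(.half t v f a h, true)]
      [(.half (M.nbr t f) (M.glue t f v) (M.glue t f f) (M.glue t f a) h', true)] := by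
  have hw : M.IsPath (.vertex (M.directedEdge t v a)) (.mid (M.boundaryEdge t v f))
      [(.half (M.nbr t f) (M.glue t f v) (M.glue t f f) (M.glue t f a) h', true)] := by
    have hvf : v ≠ f := by simp_all
    have haf : a ≠ f := by rintro rfl; simp_all
    have := isPath_half (M := M) (t := M.nbr t f) h'
    rwa [directedEdge_glue hvf haf, boundaryEdge_glue hvf] at this
  refine .of_append_reverse hw ?_ (isPath_half h)
  exact .cell (.bigon t v f a h h') ((isPath_half h).append hw.reverse)

/-- The path along the side `f` of a triangle from its corner `a` to its corner `b`. -/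
def sidePath (t : T) (v f a b : Fin 4) (ha : [v, f, a].Nodup) (hb : [v, f, b].Nodup) : Word T :=
  [(.half t v f a ha, true), (.half t v f b hb, false)]

lemma sidePath_equiv (ha : [v, f, a].Nodup) (hb : [v, f, b].Nodup) :
    M.PathEquiv (.vertex (M.directedEdge t v a)) (.vertex (M.directedEdge t v b))
      (sidePath t v f a b ha hb)
      (Word.reverse (centreToCorner t v f a ha) ++ centreToCorner t v f b hb) := by
  have h1 : M.IsPath (.centre t v) (.mid (M.boundaryEdge t v f))
      [(.spoke t v f (by simp_all), true)] := by
    simp [src, tgt, arcSrc, arcTgt]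
  have := ((PathEquiv.reverse_append h1).symm.append_left (isPath_half (M := M) (t := t) ha)).append_right
    (isPath_half (M := M) (t := t) hb).reverse
  simpa [sidePath, centreToCorner] using this

lemma sidePath_equiv_glue (ha : [v, f, a].Nodup) (hb : [v, f, b].Nodup)
    (ha' : [M.glue t f v, M.glue t f f, M.glue t f a].Nodup)
    (hb' : [M.glue t f v, M.glue t f f, M.glue t f b].Nodup) :
    M.PathEquiv (.vertex (M.directedEdge t v a)) (.vertex (M.directedEdge t v b))
      (sidePath t v f a b ha hb)
      (sidePath (M.nbr t f) (M.glue t f v) (M.glue t f f) (M.glue t f a) (M.glue t f b) ha' hb') :=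
  (half_equiv_glue ha ha').append (half_equiv_glue hb hb').reverse

lemma realize_singleton (d : TriangleSide T) :
    realize o [d] = sidePath d.t d.v d.f (rotate (o d.t) d.v d.f)
      (rotate (o d.t) d.v (rotate (o d.t) d.v d.f)) (toDirectedSide o d).distinct_a
      (toDirectedSide o d).distinct_b := by
  simp [realize, DirectedSide.path, toDirectedSide, sidePath]

lemma realize_rev_equiv (d : TriangleSide T) :
    M.PathEquiv (.vertex ((boundarySurface ho).tgt d)) (.vertex ((boundarySurface ho).src d))
      (realize o [(boundarySurface ho).rev d]) (Word.reverse (realize o [d])) := by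
  have ha := (toDirectedSide o d).distinct_a
  have hb := (toDirectedSide o d).distinct_b
  simp only [toDirectedSide] at ha hb
  have hinj : ∀ {i : Fin 4}, [d.v, d.f, i].Nodup →
      [M.glue d.t d.f d.v, M.glue d.t d.f d.f, M.glue d.t d.f i].Nodup := fun h => by
    simpa using h.map (M.glue d.t d.f).injective
  have key : ∀ (i j : Fin 4) (hi : [M.glue d.t d.f d.v, M.glue d.t d.f d.f, i].Nodup)
      (hj : [M.glue d.t d.f d.v, M.glue d.t d.f d.f, j].Nodup),
      i = M.glue d.t d.f (rotate (o d.t) d.v (rotate (o d.t) d.v d.f)) →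
      j = M.glue d.t d.f (rotate (o d.t) d.v d.f) →
      M.PathEquiv (.vertex ((boundarySurface ho).tgt d)) (.vertex ((boundarySurface ho).src d))
        (sidePath (M.nbr d.t d.f) (M.glue d.t d.f d.v) (M.glue d.t d.f d.f) i j hi hj)
        (Word.reverse (realize o [d])) := by
    rintro _ _ hi hj rfl rfl
    have := (sidePath_equiv_glue (M := M) hb ha hi hj).symm
    rw [realize_singleton, boundarySurface_tgt, boundarySurface_src]
    simpa [sidePath, Word.reverse] using this
  rw [realize_singleton]
  refine key _ _ _ _ ?_ ?_
  · exact ho.rotate_glue _ _ _ _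
  · simp only [boundarySurface]
    rw [ho.rotate_glue, ho.rotate_glue]
    simp

lemma nodup_of_ne (h1 : v ≠ f) (h2 : v ≠ a) (h3 : a ≠ f) : [v, f, a].Nodup := by
  simp [h1, h2, h3.symm]

/-- The paths between corners of a triangle are homotopic to those through the centre. -/
lemma realize_cornerPath_equiv (ha : v ≠ a) (hb : v ≠ b) (hf : [v, f, a].Nodup)
    (hg : [v, g, b].Nodup) :
    M.PathEquiv (.vertex (M.directedEdge t v a)) (.vertex (M.directedEdge t v b))
      (realize o (cornerPath ho t v a b ha hb))
      (Word.reverse (centreToCorner t v f a hf) ++ centreToCorner t v g b hg) := by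
  have indep : ∀ {e : Fin 4} (h1 : [v, e, a].Nodup) (h2 : [v, e, b].Nodup),
      M.PathEquiv (.vertex (M.directedEdge t v a)) (.vertex (M.directedEdge t v b))
        (sidePath t v e a b h1 h2)
        (Word.reverse (centreToCorner t v f a hf) ++ centreToCorner t v g b hg) := fun h1 h2 =>
    (sidePath_equiv h1 h2).trans
      ((centreToCorner_equiv h1 hf).reverse.append (centreToCorner_equiv h2 hg))
  rcases eq_rotate (o t) ha hb with rfl | rfl | rfl
  · rw [cornerPath_self, realize_nil]
    exact ((centreToCorner_equiv hf hg).reverse.append_right (isPath_centreToCorner hg)).trans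
      (.reverse_append (isPath_centreToCorner hg)) |>.symm
  · rw [cornerPath_rotate, realize_singleton]
    simp only [rotate_rotate_rotate]
    exact indep _ _
  · have hr := rotate_ne_left (o t) v a ha
    have h := realize_rev_equiv ho ⟨t, v, rotate (o t) v a, hr⟩
    rw [realize_singleton (d := ⟨t, v, rotate (o t) v a, hr⟩), boundarySurface_src,
      boundarySurface_tgt] at h
    simp only [rotate_rotate_rotate] at h
    rw [cornerPath_rotate_rotate]
    refine h.trans ?_
    have h1 : [v, rotate (o t) v a, a].Nodup := nodup_of_ne hr ha (rotate_ne_right _ _ _ ha).symm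
    have h2 : [v, rotate (o t) v a, rotate (o t) v (rotate (o t) v a)].Nodup :=
      nodup_of_ne hr hb (rotate_ne_right _ _ _ hr)
    simpa [sidePath, Word.reverse] using indep h1 h2

lemma exists_side (h : v ≠ a) : ∃ f, [v, f, a].Nodup := by
  revert v a; decide

/-- Simplicial homotopies are homotopies in the cell structure, as the sides of a triangle can be pushed
to its centre. -/
lemma realize_homotopic {p q : M.DirectedEdge} {l m : List (TriangleSide T)}
    (h : (boundarySurface ho).Homotopic p q l m) :
    M.PathEquiv (.vertex p) (.vertex q) (realize o l) (realize o m) := by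
  induction h with
  | refl h => exact .refl (isPath_realize ho h)
  | symm _ ih => exact ih.symm
  | trans _ _ ih ih' => exact ih.trans ih'
  | @spur u w d hu hw =>
    have h1 : M.PathEquiv (.vertex ((boundarySurface ho).src d))
        (.vertex ((boundarySurface ho).src d))
        (realize o [d] ++ realize o [(boundarySurface ho).rev d]) [] :=
      ((realize_rev_equiv ho d).append_left (isPath_realize_singleton ho d)).trans
        (.append_reverse (isPath_realize_singleton ho d))
    have := (h1.append_left (isPath_realize ho hu)).append_right (isPath_realize ho hw)
    rw [realize_append, realize_append, realize_cons, realize_cons _ w]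
    simpa using this
  | @face u w d hu hw =>
    have hside : ∀ e : TriangleSide T, ∀ (f g : Fin 4)
        (hf : [e.v, f, rotate (o e.t) e.v e.f].Nodup)
        (hg : [e.v, g, rotate (o e.t) e.v (rotate (o e.t) e.v e.f)].Nodup),
        M.PathEquiv (.vertex ((boundarySurface ho).src e)) (.vertex ((boundarySurface ho).tgt e))
          (realize o [e]) (Word.reverse (centreToCorner e.t e.v f _ hf) ++
            centreToCorner e.t e.v g _ hg) := by
      intro e f g hf hg
      have h1 := rotate_ne_left (o e.t) _ _ e.v_ne_f
      have := realize_cornerPath_equiv ho (t := e.t) h1 (rotate_ne_left (o e.t) _ _ h1) hf hg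
      rw [cornerPath_rotate] at this
      simp only [rotate_rotate_rotate] at this
      rwa [boundarySurface_src, boundarySurface_tgt]
    obtain ⟨f₀, hf₀⟩ := exists_side d.v_ne_f
    have h1 := rotate_ne_left (o d.t) _ _ d.v_ne_f
    obtain ⟨f₁, hf₁⟩ := exists_side h1
    obtain ⟨f₂, hf₂⟩ := exists_side (rotate_ne_left (o d.t) _ _ h1)
    have e0 := hside d f₁ f₂ hf₁ hf₂
    have e1 := hside ((boundarySurface ho).next d) f₂ f₀ hf₂ (by simpa [boundarySurface_next] using hf₀)
    have e2 := hside ((boundarySurface ho).next ((boundarySurface ho).next d)) f₀ f₁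
      (by simpa [boundarySurface_next] using hf₀) (by simpa [boundarySurface_next] using hf₁)
    have hface : M.PathEquiv (.vertex ((boundarySurface ho).src d))
        (.vertex ((boundarySurface ho).src d)) (realize o [d] ++
          (realize o [(boundarySurface ho).next d] ++
            realize o [(boundarySurface ho).next ((boundarySurface ho).next d)])) [] := by
      refine .triangle (isPath_centreToCorner hf₀) (isPath_centreToCorner hf₁)
        (isPath_centreToCorner hf₂) ?_ ?_ ?_
      · simpa using e0
      · simpa [boundarySurface_next] using e1
      · simpa [boundarySurface_next] using e2
    have := (hface.append_left (isPath_realize ho hu)).append_right (isPath_realize ho hw)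
    rw [realize_append, realize_append, realize_cons, realize_cons _ (_ :: w), realize_cons _ w]
    simpa using this

lemma realize_inv_equiv {p q : M.DirectedEdge} {l : List (TriangleSide T)}
    (h : (boundarySurface ho).IsWalk p q l) :
    M.PathEquiv (.vertex q) (.vertex p) (realize o ((boundarySurface ho).inv l))
      (Word.reverse (realize o l)) := by
  induction l generalizing p with
  | nil =>
    obtain rfl : p = q := h
    exact .refl rfl
  | cons d l ih =>
    obtain ⟨rfl, h⟩ := h
    rw [OrientedTriangulation.inv_cons, realize_append, realize_cons d l, reverse_append]
    exact (ih h).append (realize_rev_equiv ho d)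

/-- Conjugate closed paths on the 1-skeleton are freely homotopic on the boundary. -/
lemma freelyHomotopic_realize {p q : M.DirectedEdge} {l m k : List (TriangleSide T)}
    (hk : (boundarySurface ho).IsWalk p q k) (hm : (boundarySurface ho).IsWalk q q m)
    (h : (boundarySurface ho).Homotopic p p l (k ++ m ++ (boundarySurface ho).inv k)) :
    M.FreelyHomotopic (realize o l) (realize o m) := by
  have h1 := realize_homotopic ho h
  have h2 := (realize_inv_equiv ho hk).append_left
    ((isPath_realize ho hk).append (isPath_realize ho hm))
  have hk' := isPath_realize ho hk
  have hm' := isPath_realize ho hm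
  have h3 := (PathEquiv.reverse_append hk').append_left hm'
  rw [realize_append, realize_append] at h1
  refine ((h1.trans h2).freelyHomotopic.trans ?_).trans (by simpa using h3.freelyHomotopic)
  have := FreelyHomotopic.rotate (M := M) (realize o k)
    (realize o m ++ Word.reverse (realize o k))
    (hk'.append (hm'.append hk'.reverse)).isClosedWalk
  simpa using this

/-! ### Every closed curve is homotopic to its projection -/

lemma boundaryEdge_eq {d e : T × Fin 4 × Fin 4}
    (h : (Quot.mk _ d : M.BoundaryEdge) = Quot.mk _ e) :
    (d.2.1 ≠ d.2.2 ↔ e.2.1 ≠ e.2.2) ∧ ∀ (hd : d.2.1 ≠ d.2.2) (he : e.2.1 ≠ e.2.2),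
      e = d ∨ (⟨e.1, e.2.1, e.2.2, he⟩ : TriangleSide T)
        = (boundarySurface ho).rev ⟨d.1, d.2.1, d.2.2, hd⟩ := by
  have h' := Quot.eqvGen_exact h
  clear h
  induction h' with
  | rel x y h =>
    obtain ⟨t, v, f, h⟩ := h
    exact ⟨by simp, fun _ _ => Or.inr rfl⟩
  | refl x => exact ⟨Iff.rfl, fun _ _ => Or.inl rfl⟩
  | symm x y _ ih =>
    refine ⟨ih.1.symm, fun hd he => ?_⟩
    rcases ih.2 he hd with h | h
    · exact Or.inl h.symm
    · exact Or.inr (by rw [h, (boundarySurface ho).rev_rev])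
  | trans x y z _ _ ih ih' =>
    refine ⟨ih.1.trans ih'.1, fun hd he => ?_⟩
    rcases ih.2 hd (ih.1.1 hd) with rfl | h
    · exact ih'.2 hd he
    · rcases ih'.2 (ih.1.1 hd) he with rfl | h'
      · exact Or.inr h
      · left
        rw [h, (boundarySurface ho).rev_rev] at h'
        simp only [TriangleSide.mk.injEq] at h'
        exact Prod.ext h'.1 (Prod.ext h'.2.1 h'.2.2)

lemma nodup_midCorner (d : TriangleSide T) : [d.v, d.f, midCorner ho d].Nodup :=
  nodup_of_ne d.v_ne_f (midCorner_ne_v ho d) (midCorner_ne_f ho d)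

/-- The path from the midpoint of a side to its chosen end. -/
noncomputable def midToVertex (d : TriangleSide T) : Word T :=
  [(.half d.t d.v d.f (midCorner ho d) (nodup_midCorner ho d), false)]

lemma isPath_midToVertex (d : TriangleSide T) :
    M.IsPath (.mid (M.boundaryEdge d.t d.v d.f))
      (.vertex (M.directedEdge d.t d.v (midCorner ho d))) (midToVertex ho d) :=
  (isPath_half (nodup_midCorner ho d)).reverse

lemma projNode_mid (d : TriangleSide T) :
    projNode ho (.mid (M.boundaryEdge d.t d.v d.f))
      = M.directedEdge d.t d.v (midCorner ho d) := by
  have := d.v_ne_f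
  simp [projNode, boundaryEdge, this]

lemma nodup_add_two_add_one (v : Fin 4) : [v, v + 2, v + 1].Nodup := by revert v; decide

open Classical in
/-- A path from a vertex of the cell structure to its projection.  (Midpoints that do not come from a side of
a triangle are isolated.) -/
noncomputable def toProjNode : M.Node → Word T
  | .centre t v => centreToCorner t v (v + 2) (v + 1) (nodup_add_two_add_one v)
  | .vertex _ => []
  | .mid e => if h : ∃ d : TriangleSide T, M.boundaryEdge d.t d.v d.f = e then
      midToVertex ho h.choose else []

lemma toProjNode_mid_equiv (d : TriangleSide T) :
    M.PathEquiv (.mid (M.boundaryEdge d.t d.v d.f))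
      (.vertex (projNode ho (.mid (M.boundaryEdge d.t d.v d.f))))
      (toProjNode ho (.mid (M.boundaryEdge d.t d.v d.f))) (midToVertex ho d) := by
  have h : ∃ e : TriangleSide T, M.boundaryEdge e.t e.v e.f = M.boundaryEdge d.t d.v d.f := ⟨d, rfl⟩
  rw [toProjNode, dif_pos h, projNode_mid]
  have hs := h.choose_spec
  set e := h.choose
  rcases (boundaryEdge_eq ho hs).2 e.v_ne_f d.v_ne_f with h | h
  · have : e = d := TriangleSide.ext (congrArg Prod.fst h).symm
      (congrArg (fun p => p.2.1) h).symm (congrArg (fun p => p.2.2) h).symm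
    rw [this]
    exact .refl (isPath_midToVertex ho d)
  · have hd : d = (boundarySurface ho).rev e := h
    have h1 := nodup_midCorner ho e
    have h2 := nodup_midCorner ho ((boundarySurface ho).rev e)
    have hm := midCorner_rev ho e
    have key : ∀ (i : Fin 4) (hi : [M.glue e.t e.f e.v, M.glue e.t e.f e.f, i].Nodup),
        i = M.glue e.t e.f (midCorner ho e) →
        M.PathEquiv (.mid (M.boundaryEdge e.t e.v e.f))
          (.vertex (M.directedEdge e.t e.v (midCorner ho e))) (midToVertex ho e)
          [(.half (M.nbr e.t e.f) (M.glue e.t e.f e.v) (M.glue e.t e.f e.f) i hi, false)] := by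
      rintro _ hi rfl
      exact (half_equiv_glue h1 hi).reverse
    have := key _ h2 hm
    have e1 := projNode_mid ho d
    rw [← hs, projNode_mid ho e] at e1
    rw [← hs, ← e1, hd]
    exact this

lemma isPath_toProjNode_mid (d : TriangleSide T) :
    M.IsPath (.mid (M.boundaryEdge d.t d.v d.f))
      (.vertex (projNode ho (.mid (M.boundaryEdge d.t d.v d.f))))
      (toProjNode ho (.mid (M.boundaryEdge d.t d.v d.f))) :=
  (toProjNode_mid_equiv ho d).1

lemma isPath_toProjNode_arcSrc (a : Arc T) :
    M.IsPath (M.arcSrc a) (.vertex (projNode ho (M.arcSrc a))) (toProjNode ho (M.arcSrc a)) := by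
  cases a with
  | spoke t v f h => exact isPath_centreToCorner _
  | half t v f w h => rfl

lemma isPath_toProjNode_arcTgt (a : Arc T) :
    M.IsPath (M.arcTgt a) (.vertex (projNode ho (M.arcTgt a))) (toProjNode ho (M.arcTgt a)) := by
  cases a with
  | spoke t v f h => exact isPath_toProjNode_mid ho ⟨t, v, f, h⟩
  | half t v f w h => exact isPath_toProjNode_mid ho ⟨t, v, f, by simp_all⟩

lemma arc_equiv (a : Arc T) : M.PathEquiv (M.arcSrc a) (M.arcTgt a) [(a, true)]
    (toProjNode ho (M.arcSrc a) ++ (realize o (projArc ho a) ++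
      Word.reverse (toProjNode ho (M.arcTgt a)))) := by
  cases a with
  | spoke t v f h =>
    have hm := nodup_midCorner ho ⟨t, v, f, h⟩
    have hv := nodup_add_two_add_one v
    have h1 := realize_cornerPath_equiv (M := M) ho (t := t) (ne_succ v)
      (midCorner_ne_v ho ⟨t, v, f, h⟩) hv hm
    have h2 := (toProjNode_mid_equiv ho ⟨t, v, f, h⟩).reverse
    rw [projNode_mid] at h2
    have h3 := (h1.append h2).append_left (isPath_centreToCorner hv)
    refine .symm (h3.trans ?_)
    have h4 := (PathEquiv.append_reverse (isPath_centreToCorner (M := M) (t := t) hv)).append_right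
      ((isPath_centreToCorner (M := M) (t := t) hm).append (isPath_midToVertex ho ⟨t, v, f, h⟩).reverse)
    have h5 : M.IsPath (.centre t v) (.mid (M.boundaryEdge t v f)) [(.spoke t v f h, true)] := by
      simp [src, tgt, arcSrc, arcTgt]
    have h6 := (PathEquiv.append_reverse (isPath_midToVertex (M := M) ho ⟨t, v, f, h⟩)).append_left h5
    simp only [List.append_assoc, List.nil_append, List.append_nil] at *
    exact h4.trans (by simpa [centreToCorner, midToVertex] using h6)
  | half t v f w h =>
    have hf : v ≠ f := by simp_all
    have hw : v ≠ w := by simp_all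
    have hm := nodup_midCorner ho ⟨t, v, f, hf⟩
    have h1 := realize_cornerPath_equiv (M := M) ho (t := t) hw
      (midCorner_ne_v ho ⟨t, v, f, hf⟩) h hm
    have h2 := (toProjNode_mid_equiv ho ⟨t, v, f, hf⟩).reverse
    rw [projNode_mid] at h2
    have h3 := h1.append h2
    refine PathEquiv.symm (PathEquiv.trans h3 ?_)
    have h4 := ((sidePath_equiv (M := M) (t := t) h hm).symm).append_right
      (isPath_midToVertex ho ⟨t, v, f, hf⟩).reverse
    have h6 := (PathEquiv.append_reverse (isPath_midToVertex (M := M) ho ⟨t, v, f, hf⟩)).append_left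
      (isPath_half (t := t) h)
    simp only [List.append_assoc, List.append_nil] at *
    exact h4.trans (by simpa [sidePath, midToVertex] using h6)

lemma letter_equiv (l : Arc T × Bool) : M.PathEquiv (M.src l) (M.tgt l) [l]
    (toProjNode ho (M.src l) ++ (realize o (projLetter ho l) ++
      Word.reverse (toProjNode ho (M.tgt l)))) := by
  rcases l with ⟨a, _ | _⟩
  · have h1 := (arc_equiv ho a).reverse
    have h2 := (((realize_inv_equiv ho (isWalk_projArc ho a)).symm).append_right
      (isPath_toProjNode_arcSrc ho a).reverse).append_left (isPath_toProjNode_arcTgt ho a)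
    simp only [reverse_append, reverse_reverse, List.append_assoc] at h1 h2
    exact h1.trans h2
  · exact arc_equiv ho a

lemma isPath_toProjNode_src (l : Arc T × Bool) :
    M.IsPath (M.src l) (.vertex (projNode ho (M.src l))) (toProjNode ho (M.src l)) := by
  rcases l with ⟨a, _ | _⟩
  · exact isPath_toProjNode_arcTgt ho a
  · exact isPath_toProjNode_arcSrc ho a

lemma path_equiv_proj (h : M.IsPath x y w)
    (hx : M.IsPath x (.vertex (projNode ho x)) (toProjNode ho x)) :
    M.PathEquiv x y w (toProjNode ho x ++ (realize o (proj ho w) ++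
      Word.reverse (toProjNode ho y))) ∧
      M.IsPath y (.vertex (projNode ho y)) (toProjNode ho y) := by
  induction w generalizing x with
  | nil =>
    obtain rfl : x = y := h
    exact ⟨(PathEquiv.append_reverse hx).symm, hx⟩
  | cons l w ih =>
    obtain ⟨rfl, h⟩ := h
    have hl := isPath_toProjNode_src ho (l.1, !l.2)
    rw [src_not] at hl
    obtain ⟨ih1, ih2⟩ := ih h hl
    refine ⟨?_, ih2⟩
    have h1 := (letter_equiv ho l).append ih1
    refine PathEquiv.trans (by simpa using h1) ?_
    have h2 := (PathEquiv.reverse_append hl).append_right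
      ((isPath_realize ho (h.proj ho)).append ih2.reverse)
    have h3 := h2.append_left (hx.append (isPath_realize ho (isWalk_projLetter ho l)))
    rw [proj_cons, realize_append]
    simpa using h3

/-- A closed curve is freely homotopic to its projection to the 1-skeleton. -/
lemma freelyHomotopic_realize_proj (h : M.IsPath x x w) (hw : w ≠ []) :
    M.FreelyHomotopic (realize o (proj ho w)) w := by
  obtain ⟨l, w', rfl⟩ := List.exists_cons_of_ne_nil hw
  obtain rfl := h.1
  have hl := isPath_toProjNode_src ho l
  have h1 := (path_equiv_proj ho h hl).1.freelyHomotopic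
  have hp := isPath_realize ho (h.proj ho)
  have h2 := FreelyHomotopic.rotate _ _ (hl.append (hp.append hl.reverse)).isClosedWalk
  have h3 := ((PathEquiv.reverse_append hl).append_left hp).freelyHomotopic
  simp only [List.append_assoc, List.append_nil] at h2 h3
  exact ((h1.trans h2).trans h3).symm

end FaceGluing

/-! ### Combinatorial area of admissible discs -/

/-- The label different from three distinct labels. -/
def fourthLabel (v f g : Fin 4) : Fin 4 := v ^^^ f ^^^ g

lemma fourthLabel_nodup {v f g : Fin 4} (h : [v, f, g].Nodup) : [v, f, g, fourthLabel v f g].Nodup := by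
  revert v f g; decide

lemma eq_fourthLabel {v f g w : Fin 4} (h : [v, f, g, w].Nodup) : w = fourthLabel v f g := by
  revert v f g w; decide

namespace AngleStructure

variable {T : Type*} [Fintype T] {M : IdealTriangulation T} (θ : AngleStructure M)

lemma vertex_sum' (t : T) {v a b c : Fin 4} (h : [v, a, b, c].Nodup) :
    θ.angle t s(v, a) + θ.angle t s(v, b) + θ.angle t s(v, c) = Real.pi := by
  have he : Finset.univ.erase v = {a, b, c} := by revert v a b c; decide
  have := θ.vertex_sum t v
  simp only [List.nodup_cons, List.mem_cons, List.not_mem_nil, or_false, not_or] at h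
  rw [he, Finset.sum_insert (by simp [h]), Finset.sum_insert (by simp [h]), Finset.sum_singleton]
    at this
  linarith

lemma angle_pos (t : T) {a b : Fin 4} (h : a ≠ b) : 0 < θ.angle t s(a, b) := (θ.angle_mem t a b h).1

/-- Opposite edges have equal angles.  So the four boundary triangles of a tetrahedron have the same three
angles. -/
lemma angle_opposite (t : T) {a b c d : Fin 4} (h : [a, b, c, d].Nodup) :
    θ.angle t s(a, b) = θ.angle t s(c, d) := by
  obtain ⟨n2, n3, n4⟩ : [b, a, c, d].Nodup ∧ [c, a, b, d].Nodup ∧ [d, a, b, c].Nodup := by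
    revert a b c d; decide
  have h1 := θ.vertex_sum' t h
  have h2 := θ.vertex_sum' t n2
  have h3 := θ.vertex_sum' t n3
  have h4 := θ.vertex_sum' t n4
  rw [Sym2.eq_swap (a := b) (b := a)] at h2
  rw [Sym2.eq_swap (a := c) (b := a), Sym2.eq_swap (a := c) (b := b)] at h3
  rw [Sym2.eq_swap (a := d) (b := a), Sym2.eq_swap (a := d) (b := b),
    Sym2.eq_swap (a := d) (b := c)] at h4
  linarith

lemma minAngle_le_angle_left (t : T) {v w : Fin 4} (h : v ≠ w) :
    θ.minAngle t v ≤ θ.angle t s(v, w) := by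
  have : w = v + 1 ∨ w = v + 2 ∨ w = v + 3 := by revert v w; decide
  rcases this with rfl | rfl | rfl <;> simp [minAngle]

lemma minAngle_le_angle (t : T) (v : Fin 4) {a b : Fin 4} (h : a ≠ b) :
    θ.minAngle t v ≤ θ.angle t s(a, b) := by
  by_cases ha : v = a
  · subst ha
    exact θ.minAngle_le_angle_left t h
  by_cases hb : v = b
  · subst hb
    rw [Sym2.eq_swap]
    exact θ.minAngle_le_angle_left t (Ne.symm h)
  have hn : [a, b, v, fourthLabel a b v].Nodup := fourthLabel_nodup (by
    simp [h, Ne.symm ha, Ne.symm hb])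
  rw [θ.angle_opposite t hn]
  refine θ.minAngle_le_angle_left t ?_
  simp_all

lemma minAngle_pos (t : T) (v : Fin 4) : 0 < θ.minAngle t v := by
  have h : ∀ v : Fin 4, v ≠ v + 1 ∧ v ≠ v + 2 ∧ v ≠ v + 3 := by decide
  exact lt_min (θ.angle_pos t (h v).1) (lt_min (θ.angle_pos t (h v).2.1) (θ.angle_pos t (h v).2.2))

/-- The exterior angle of an edge is the sum of the two other interior angles. -/
lemma two_mul_minAngle_le (t : T) (v : Fin 4) {a b : Fin 4} (h : a ≠ b) :
    2 * θ.minAngle t v ≤ Real.pi - θ.angle t s(a, b) := by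
  obtain ⟨c, d, hn⟩ : ∃ c d, [a, b, c, d].Nodup := by revert a b; decide
  have h1 := θ.vertex_sum' t hn
  have h2 := θ.minAngle_le_angle t v (a := a) (b := c) (by simp_all)
  have h3 := θ.minAngle_le_angle t v (a := a) (b := d) (by simp_all)
  linarith

lemma three_mul_minAngle_le (t : T) (v : Fin 4) : 3 * θ.minAngle t v ≤ Real.pi := by
  have h1 := θ.two_mul_minAngle_le t v (a := 0) (b := 1) (by decide)
  have h2 := θ.minAngle_le_angle t v (a := 0) (b := 1) (by decide)
  linarith

lemma cost_nonneg (t : T) {x : Segment} (h : x.Valid) : 0 ≤ x.cost (θ.angle t) := by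
  have hpi := Real.pi_pos
  cases x with
  | strip a b f g =>
    have := (θ.angle_mem t a b (by simp_all [Segment.Valid])).2
    simp only [Segment.cost]
    linarith
  | cusp v f g => exact hpi.le
  | gap f g => simp only [Segment.cost]; linarith

lemma sum_cost_nonneg (t : T) {l : List Segment} (h : ∀ x ∈ l, x.Valid) :
    0 ≤ (l.map (Segment.cost (θ.angle t))).sum := by
  refine List.sum_nonneg fun r hr => ?_
  obtain ⟨x, hx, rfl⟩ := List.mem_map.1 hr
  exact θ.cost_nonneg t (h x hx)

/-- Every segment that is not an arc in `∂M` costs at least an exterior angle, which is at least twice the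
smallest angle. -/
lemma le_sum_cost (t : T) (v : Fin 4) {l : List Segment} (h : ∀ x ∈ l, x.Valid) :
    Real.pi * l.countP Segment.isCusp + 2 * θ.minAngle t v * (l.length - l.countP Segment.isCusp)
      ≤ (l.map (Segment.cost (θ.angle t))).sum := by
  have hpi := Real.pi_pos
  have h3 := θ.three_mul_minAngle_le t v
  have h0 := θ.minAngle_pos t v
  induction l with
  | nil => simp
  | cons x l ih =>
    have ih := ih fun y hy => h y (List.mem_cons_of_mem _ hy)
    have hx := h x List.mem_cons_self
    rw [List.map_cons, List.sum_cons, List.countP_cons, List.length_cons]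
    cases x with
    | strip a b f g =>
      have := θ.two_mul_minAngle_le t v (a := a) (b := b) (by simp_all [Segment.Valid])
      simp only [Segment.cost, Segment.isCusp, Bool.false_eq_true, if_false]
      push_cast
      linarith
    | cusp v f g =>
      simp only [Segment.cost, Segment.isCusp, if_true]
      push_cast
      linarith
    | gap f g =>
      simp only [Segment.cost, Segment.isCusp, Bool.false_eq_true, if_false]
      push_cast
      linarith

/-- A disc with a single arc in `∂M`, and without arcs in the interior of the 0-handle, starts and ends with
the strips of the two edges that separate the corner of its arc from the other two corners. -/
lemma minAngle_le_of_strips (t : T) {v f g : Fin 4} (hv : [v, f, g].Nodup) {rest : List Segment}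
    (hvalid : ∀ x ∈ rest, x.Valid) (hstrip : ∀ x ∈ rest, ∃ a b f g, x = .strip a b f g)
    (hlink : (.cusp v f g :: (rest ++ [.cusp v f g])).IsChain Segment.Linked) :
    θ.minAngle t v ≤ (rest.map (Segment.cost (θ.angle t))).sum - Real.pi := by
  have hw := fourthLabel_nodup hv
  set w := fourthLabel v f g
  cases rest with
  | nil =>
    simp only [List.nil_append, List.isChain_cons_cons] at hlink
    have := hlink.1.1
    simp only [Segment.tgtFace, Segment.srcFace] at this
    simp_all
  | cons x l =>
    obtain ⟨a, b, f₁, g₁, rfl⟩ := hstrip x List.mem_cons_self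
    have hx := hvalid _ List.mem_cons_self
    rw [List.cons_append, List.isChain_cons_cons] at hlink
    obtain ⟨⟨h1, h2⟩, hlink⟩ := hlink
    simp only [Segment.tgtFace, Segment.srcFace] at h1
    simp only [Segment.side, FaceSide.Admissible, Sym2.mem_iff, not_or] at h2
    subst h1
    simp only [Segment.Valid] at hx
    have hfirst : g₁ = v ∧ s(a, b) = s(f, w) := by
      revert hx h2 hw
      generalize w = w
      clear hlink hvalid hstrip
      revert v f g a b g₁ w
      decide
    rcases List.eq_nil_or_concat l with rfl | ⟨mid, y, rfl⟩
    · rw [List.nil_append, List.isChain_cons_cons] at hlink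
      have := hlink.1.1
      simp only [Segment.tgtFace, Segment.srcFace] at this
      rw [hfirst.1] at this
      simp_all
    · rw [List.concat_eq_append] at *
      obtain ⟨a', b', f', g', rfl⟩ := hstrip y (by simp)
      have hy := hvalid (.strip a' b' f' g') (by simp)
      have hlast : Segment.Linked (.strip a' b' f' g') (.cusp v f g) := by
        have := hlink
        rw [List.append_assoc, ← List.cons_append] at this
        have := (List.isChain_append.1 this).2.1
        simpa using this
      obtain ⟨h3, h4⟩ := hlast
      simp only [Segment.tgtFace, Segment.srcFace] at h3
      simp only [Segment.side, FaceSide.Admissible, Sym2.mem_iff, not_or] at h4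
      subst h3
      simp only [Segment.Valid] at hy
      have hlast : s(a', b') = s(g, w) := by
        revert hy h4 hw
        generalize w = w
        clear hlink hvalid hstrip hfirst hx h2
        revert v g' g a' b' f' w
        decide
      have hmid := θ.sum_cost_nonneg t (l := mid) fun x hx => hvalid x (by simp [hx])
      have hvert := θ.vertex_sum' t (v := w) (a := v) (b := g') (c := g) (by
        revert hw; generalize w = w; clear hlink hvalid hstrip hfirst hlast hx h2 h4 hy hmid
        revert v g' g w; decide)
      have hmin := θ.minAngle_le_angle t v (a := w) (b := v) (by
        revert hw; generalize w = w; clear hlink hvalid hstrip hfirst hlast hx h2 h4 hy hmid hvert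
        revert v g' g w; decide)
      simp only [List.map_cons, List.map_append, List.map_nil, List.sum_cons, List.sum_append,
        List.sum_nil, Segment.cost, hfirst.2, hlast]
      rw [Sym2.eq_swap (a := g') (b := w), Sym2.eq_swap (a := g) (b := w)]
      linarith

/-- Apart from the discs that run around an edge and meet `∂M` at both of its ends, whose area vanishes, the
area of an admissible disc per arc in `∂M` is at least the smallest angle of any triangle of `∂M` that it
meets. -/
lemma minAngle_le_area_div (t : T) {v f g : Fin 4} {rest : List Segment}
    (hvalid : ∀ x ∈ .cusp v f g :: rest, x.Valid)
    (hlink : (.cusp v f g :: (rest ++ [.cusp v f g])).IsChain Segment.Linked) :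
    rest = [.cusp (fourthLabel v f g) g f] ∨ θ.minAngle t v ≤
      Segment.area (θ.angle t) (.cusp v f g :: rest) / Segment.cuspCount (.cusp v f g :: rest) := by
  have hpi := Real.pi_pos
  have h3 := θ.three_mul_minAngle_le t v
  have h0 := θ.minAngle_pos t v
  have hv : [v, f, g].Nodup := hvalid _ List.mem_cons_self
  have hrest : ∀ x ∈ rest, x.Valid := fun x hx => hvalid x (List.mem_cons_of_mem _ hx)
  have hsum := θ.le_sum_cost t v hrest
  have harea : Segment.area (θ.angle t) (.cusp v f g :: rest)
      = (rest.map (Segment.cost (θ.angle t))).sum - Real.pi := by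
    simp only [Segment.area, List.map_cons, List.sum_cons, Segment.cost]
    ring
  have hcount : Segment.cuspCount (.cusp v f g :: rest) = rest.countP Segment.isCusp + 1 := by
    simp [Segment.cuspCount, List.countP_cons, Segment.isCusp]
  rw [harea, hcount]
  have hlen : rest.countP Segment.isCusp ≤ rest.length := List.countP_le_length
  have hlen' : (rest.countP Segment.isCusp : ℝ) ≤ rest.length := by exact_mod_cast hlen
  rcases Nat.lt_or_ge (rest.countP Segment.isCusp) 2 with hc | hc
  · interval_cases hc' : rest.countP Segment.isCusp
    · right
      simp only [zero_add, Nat.cast_one, div_one]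
      by_cases hgap : ∃ f' g', Segment.gap f' g' ∈ rest
      · obtain ⟨f', g', hmem⟩ := hgap
        have : Segment.cost (θ.angle t) (.gap f' g') ≤ (rest.map (Segment.cost (θ.angle t))).sum := by
          refine List.single_le_sum (fun r hr => ?_) _ (List.mem_map_of_mem hmem)
          obtain ⟨x, hx, rfl⟩ := List.mem_map.1 hr
          exact θ.cost_nonneg t (hrest x hx)
        simp only [Segment.cost] at this
        linarith
      · refine θ.minAngle_le_of_strips t hv hrest (fun x hx => ?_) hlink
        cases x with
        | strip a b f g => exact ⟨a, b, f, g, rfl⟩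
        | cusp v f g => exact absurd (List.countP_eq_zero.1 hc' _ hx) (by simp [Segment.isCusp])
        | gap f g => exact absurd ⟨f, g, hx⟩ hgap
    · by_cases hl : rest.length = 1
      · left
        obtain ⟨x, rfl⟩ := List.length_eq_one_iff.1 hl
        have hx := hrest x (by simp)
        simp only [List.singleton_append, List.isChain_cons_cons] at hlink
        obtain ⟨⟨h1, h2⟩, ⟨h4, -⟩, -⟩ := hlink
        cases x with
        | strip a b f g => simp [Segment.isCusp] at hc'
        | gap f g => simp [Segment.isCusp] at hc'
        | cusp w f' g' =>
          simp only [Segment.tgtFace, Segment.srcFace] at h1 h4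
          simp only [Segment.side, FaceSide.Admissible] at h2
          subst h1 h4
          simp only [Segment.Valid] at hx
          have hvw : v ≠ w := h2
          have hn : [v, g', g, w].Nodup := by
            clear hsum harea hcount hlen hlen' hc hc' hl hrest hvalid h2
            simp only [List.nodup_cons, List.mem_cons, List.not_mem_nil, or_false, not_or,
              not_false_eq_true, List.nodup_nil, and_true] at hx hv ⊢
            exact ⟨⟨hv.1.1, hv.1.2, hvw⟩, ⟨hv.2, Ne.symm hx.1.2⟩, Ne.symm hx.1.1⟩
          rw [eq_fourthLabel hn]
      · right
        have h2 : (2 : ℝ) ≤ rest.length := by exact_mod_cast (by omega : 2 ≤ rest.length)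
        rw [le_div_iff₀ (by norm_num)]
        push_cast at hsum ⊢
        nlinarith
  · right
    have hc2 : (2 : ℝ) ≤ rest.countP Segment.isCusp := by exact_mod_cast hc
    rw [le_div_iff₀ (by positivity)]
    push_cast
    nlinarith

lemma area_div_nonneg (t : T) {v f g : Fin 4} {rest : List Segment}
    (hvalid : ∀ x ∈ .cusp v f g :: rest, x.Valid)
    (hlink : (.cusp v f g :: (rest ++ [.cusp v f g])).IsChain Segment.Linked) :
    0 ≤ Segment.area (θ.angle t) (.cusp v f g :: rest) /
      Segment.cuspCount (.cusp v f g :: rest) := by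
  rcases θ.minAngle_le_area_div t hvalid hlink with rfl | h
  · have : Segment.area (θ.angle t) [.cusp v f g, .cusp (fourthLabel v f g) g f] = 0 := by
      simp only [Segment.area, List.map_cons, List.map_nil, List.sum_cons, List.sum_nil, Segment.cost]
      ring
    rw [this, zero_div]
  · exact (θ.minAngle_pos t v).le.trans h

end AngleStructure

/-! ### Simplicial curves following handle curves -/

namespace FaceGluing

variable {T : Type*} {M : FaceGluing T} {o : T → ℤˣ} (ho : M.IsOrientation o)

/-- A closed curve in the dual graph can be pushed into the 1-skeleton, choosing a corner `w` in every
triangle it visits: this is the contribution to the holonomy of passing from one triangle to the next. -/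
lemma hol_proj_spokes {G : Type*} [Group G] (ω : (boundarySurface ho).Holonomy G) {t t' : T}
    {v v' g f' w b : Fin 4} (ht : t' = M.nbr t g) (hv : v' = M.glue t g v) (hf : f' = M.glue t g g)
    (hvg : v ≠ g) (hvf' : v' ≠ f') (hw : v ≠ w) (hb : v ≠ b) (hbg : b ≠ g)
    {w' : Fin 4} (hw' : v' ≠ w') (hbw : w' = M.glue t g b) :
    ω.hol (proj ho [(.spoke t v g hvg, true), (.spoke t' v' f' hvf', false)])
      = ω.hol (cornerPath ho t v (v + 1) w (ne_succ v) hw) * ω.hol (cornerPath ho t v w b hw hb)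
        * (ω.hol (cornerPath ho t' v' (v' + 1) w' (ne_succ v') hw'))⁻¹ := by
  subst ht hv hf hbw
  have hm := midCorner_rev ho ⟨t, v, g, hvg⟩
  simp only [boundarySurface] at hm
  have hg := cornerPath_glue ho (t := t) hvg (midCorner_ne_v ho ⟨t, v, g, hvg⟩) hb
    (midCorner_ne_f ho ⟨t, v, g, hvg⟩) hbg
    ((M.glue t g).injective.ne (midCorner_ne_v ho ⟨t, v, g, hvg⟩)) hw'
  simp only [proj_cons, projLetter, projArc, inv_cornerPath, proj_nil, List.append_nil,
    OrientedTriangulation.Holonomy.hol_append, if_true, Bool.false_eq_true, if_false, hm]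
  rw [← OrientedTriangulation.Holonomy.hol_inv, inv_cornerPath, ← hol_cornerPath_mul ho ω _ hw' _,
    hg, ← mul_assoc, hol_cornerPath_mul, hol_cornerPath_mul]

/-- The projection of a directed side runs along this side. -/
lemma proj_path (d : DirectedSide T) : proj ho d.path
    = cornerPath ho d.t d.v d.a d.b (by have := d.distinct_a; simp_all)
      (by have := d.distinct_b; simp_all) := by
  obtain ⟨t, v, f, a, b, ha, hb, hab⟩ := d
  have hf : v ≠ f := by simp_all
  have key : ∀ m, v ≠ m → m ≠ f → m = a ∨ m = b := by
    revert v f a b; decide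
  simp only [DirectedSide.path, proj_cons, projLetter, projArc, inv_cornerPath, proj_nil,
    List.append_nil, if_true, Bool.false_eq_true, if_false]
  have path : ∀ (m : Fin 4) (hm : v ≠ m) (ha : v ≠ a) (hb : v ≠ b), m = a ∨ m = b →
      cornerPath ho t v a m ha hm ++ cornerPath ho t v m b hm hb = cornerPath ho t v a b ha hb := by
    rintro m hm ha hb (rfl | rfl) <;> simp
  exact path _ _ _ _ (key _ (midCorner_ne_v ho ⟨t, v, f, hf⟩) (midCorner_ne_f ho ⟨t, v, f, hf⟩))

end FaceGluing

lemma finRange_eq_map_range (n : ℕ) [NeZero n] :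
    List.finRange n = (List.range n).map (Fin.ofNat n) := by
  refine List.ext_getElem (by simp) fun i h1 h2 => ?_
  ext
  simp only [List.length_finRange] at h1
  simp [Nat.mod_eq_of_lt h1]

lemma ofNat_succ (n k : ℕ) [NeZero n] : Fin.ofNat n (k + 1) = Fin.ofNat n k + 1 := by
  ext
  simp [Fin.val_add]

/-- Conjugating the factors of a cyclic product with elements that cancel conjugates the product. -/
lemma isConj_prod_finRange {G : Type*} [Group G] {n : ℕ} [NeZero n] {x y h : Fin n → G}
    (hx : ∀ i, x i = h i * y i * (h (i + 1))⁻¹) :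
    IsConj ((List.finRange n).map x).prod ((List.finRange n).map y).prod := by
  have key : ∀ k : ℕ, (((List.range k).map (Fin.ofNat n)).map x).prod
      = h 0 * (((List.range k).map (Fin.ofNat n)).map y).prod * (h (Fin.ofNat n k))⁻¹ := by
    intro k
    induction k with
    | zero => simp
    | succ k ih =>
      rw [List.range_succ, List.map_append, List.map_append, List.map_append, List.prod_append,
        List.prod_append, ih, ofNat_succ]
      simp only [List.map_cons, List.map_nil, List.prod_singleton, hx]
      group
  have h1 := key n
  rw [← finRange_eq_map_range, (by ext; simp : Fin.ofNat n n = 0)] at h1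
  rw [h1]
  exact isConj_iff.2 ⟨(h 0)⁻¹, by group⟩

namespace OrientedTriangulation

lemma isWalk_flatMap_finRange {D V : Type*} (K : OrientedTriangulation D V) {n : ℕ} [NeZero n]
    {p : Fin n → V} {e : Fin n → List D} (h : ∀ i, K.IsWalk (p i) (p (i + 1)) (e i)) :
    K.IsWalk (p 0) (p 0) ((List.finRange n).flatMap e) := by
  have key : ∀ k : ℕ, K.IsWalk (p 0) (p (Fin.ofNat n k))
      (((List.range k).map (Fin.ofNat n)).flatMap e) := by
    intro k
    induction k with
    | zero => simp
    | succ k ih =>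
      rw [List.range_succ, List.map_append, List.flatMap_append, ofNat_succ]
      refine ih.append ?_
      simpa using h (Fin.ofNat n k)
  have h1 := key n
  rwa [← finRange_eq_map_range, (by ext; simp : Fin.ofNat n n = 0)] at h1

lemma Holonomy.hol_flatMap {D V ι G : Type*} [Group G] {K : OrientedTriangulation D V}
    (ω : K.Holonomy G) (e : ι → List D) (l : List ι) :
    ω.hol (l.flatMap e) = (l.map fun i => ω.hol (e i)).prod := by
  induction l with
  | nil => simp
  | cons i l ih => simp [ih]

end OrientedTriangulation

namespace AngleStructure

open FaceGluing

variable {T : Type*} [Fintype T] {M : IdealTriangulation T} (θ : AngleStructure M)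
  {o : T → ℤˣ} (ho : M.IsOrientation o)

lemma edgeLength_pos (t : T) (v f : Fin 4) : 0 < θ.edgeLength t v f :=
  half_pos (lt_min (θ.minAngle_pos _ _) (θ.minAngle_pos _ _))

lemma edgeLength_glue (t : T) (v f : Fin 4) :
    θ.edgeLength (M.nbr t f) (M.glue t f v) (M.glue t f f) = θ.edgeLength t v f := by
  rw [edgeLength, edgeLength, M.nbr_nbr, M.glue_symm_apply, min_comm]

/-- The total length of a path in the 1-skeleton. -/
noncomputable def pathLength (l : List (TriangleSide T)) : ℝ :=
  (l.map fun d => θ.edgeLength d.t d.v d.f).sum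

variable {t : T} {v a b f : Fin 4}

lemma pathLength_cornerPath (ha : v ≠ a) (hb : v ≠ b) (h : [v, a, b, f].Nodup) :
    θ.pathLength (cornerPath ho t v a b ha hb) = θ.edgeLength t v f := by
  have hf : v ≠ f := by simp_all
  have hab : a ≠ b := by simp_all
  rcases eq_rotate (o t) ha hb with rfl | rfl | rfl
  · exact absurd rfl hab
  · have : f = rotate (o t) v (rotate (o t) v a) := by
      rcases eq_rotate (o t) ha hf with rfl | rfl | h'
      · simp_all
      · simp_all
      · exact h'
    rw [cornerPath_rotate]
    simp [pathLength, this]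
  · have : f = rotate (o t) v a := by
      rcases eq_rotate (o t) ha hf with rfl | h' | rfl
      · simp_all
      · exact h'
      · simp_all
    rw [cornerPath_rotate_rotate]
    simp [pathLength, this, boundarySurface, edgeLength_glue]

lemma pathLength_cornerPath_le (ha : v ≠ a) (hb : v ≠ b) :
    θ.pathLength (cornerPath ho t v a b ha hb) ≤ θ.minAngle t v / 2 := by
  by_cases hab : a = b
  · subst hab
    have := θ.minAngle_pos t v
    simp only [cornerPath_self, pathLength, List.map_nil, List.sum_nil]
    linarith
  · obtain ⟨f, hf⟩ : ∃ f, [v, a, b, f].Nodup := by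
      revert v a b; decide
    rw [θ.pathLength_cornerPath ho ha hb hf]
    exact div_le_div_of_nonneg_right (min_le_left _ _) two_pos.le

/-- The path between corners of two adjacent triangles lies on their common edge. -/
lemma pathLength_cornerPath_le_nbr {g t' v' : _} (ht : t' = M.nbr t g) (hv : v' = M.glue t g v)
    (hvg : v ≠ g) (ha : v ≠ a) (hb : v ≠ b) (hag : a ≠ g) (hbg : b ≠ g) :
    θ.pathLength (cornerPath ho t v a b ha hb) ≤ θ.minAngle t' v' / 2 := by
  subst ht hv
  rw [← cornerPath_glue ho hvg ha hb hag hbg ((M.glue t g).injective.ne ha)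
    ((M.glue t g).injective.ne hb)]
  exact θ.pathLength_cornerPath_le ho _ _

lemma pathLength_flatMap {ι : Type*} (e : ι → List (TriangleSide T)) (l : List ι) :
    θ.pathLength (l.flatMap e) = (l.map fun i => θ.pathLength (e i)).sum := by
  induction l with
  | nil => simp [pathLength]
  | cons i l ih =>
    rw [List.map_cons, List.sum_cons, ← ih]
    simp [pathLength]

/-- The weight of an inward extension bounds the length of some closed path in the 1-skeleton with the
homotopy class of the curve.  In the triangle of the arc `i` the path visits the corner between the two
sides that are crossed; two consecutive such corners lie on a common edge.  They agree if both discs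
have zero area; otherwise half of the area of one of the discs pays for the edge. -/
lemma exists_walk_le_weight {G : Type*} [Group G] (ω : (boundarySurface ho).Holonomy G) {n : ℕ}
    [NeZero n] {C : M.HandleCurve n} (E : C.InwardExtension) :
    ∃ p m, (boundarySurface ho).IsWalk p p m ∧ IsConj (ω.hol (proj ho C.word)) (ω.hol m) ∧
      θ.pathLength m ≤ θ.weight E := by
  have hnd : ∀ i, [C.v i, C.f i, C.g i].Nodup := fun i => E.valid i _ List.mem_cons_self
  obtain ⟨w, hw⟩ : ∃ w : Fin n → Fin 4, ∀ i, w i = fourthLabel (C.v i) (C.f i) (C.g i) :=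
    ⟨_, fun _ => rfl⟩
  have hnd4 : ∀ i, [C.v i, C.f i, C.g i, w i].Nodup := fun i => hw i ▸ fourthLabel_nodup (hnd i)
  have hvw : ∀ i, C.v i ≠ w i := fun i h => by have := hnd4 i; simp_all
  have hwf : ∀ i, w i ≠ C.f i := fun i h => by have := hnd4 i; simp_all
  have hwg : ∀ i, w i ≠ C.g i := fun i h => by have := hnd4 i; simp_all
  obtain ⟨b, hb⟩ : ∃ b : Fin n → Fin 4, ∀ i, w (i + 1) = M.glue (C.t i) (C.g i) (b i) :=
    ⟨fun i => (M.glue (C.t i) (C.g i)).symm (w (i + 1)), fun i => by simp⟩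
  have hvb : ∀ i, C.v i ≠ b i := fun i h => hvw (i + 1) (by rw [hb, C.v_succ, h])
  have hbg : ∀ i, b i ≠ C.g i := fun i h => hwf (i + 1) (by rw [hb, C.f_succ, h])
  let e : Fin n → List (TriangleSide T) := fun i =>
    cornerPath ho (C.t i) (C.v i) (w i) (b i) (hvw i) (hvb i)
  refine ⟨_, (List.finRange n).flatMap e,
    (boundarySurface ho).isWalk_flatMap_finRange
      (p := fun i => M.directedEdge (C.t i) (C.v i) (w i)) fun i => ?_, ?_, ?_⟩
  · rw [C.t_succ, C.v_succ, hb, directedEdge_glue (C.v_ne_g i) (hbg i)]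
    exact isWalk_cornerPath ho _ _
  · have : proj ho C.word = (List.finRange n).flatMap fun i => proj ho
        [(.spoke (C.t i) (C.v i) (C.g i) (C.v_ne_g i), true),
          (.spoke (C.t (i + 1)) (C.v (i + 1)) (C.f (i + 1)) (C.v_ne_f (i + 1)), false)] := by
      simp only [HandleCurve.word, proj, List.flatMap_assoc]
    rw [this, ω.hol_flatMap, ω.hol_flatMap]
    exact isConj_prod_finRange fun i => hol_proj_spokes ho ω (C.t_succ i) (C.v_succ i) (C.f_succ i)
      (C.v_ne_g i) (C.v_ne_f (i + 1)) (hvw i) (hvb i) (hbg i) (hvw (i + 1)) (hb i)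
  · obtain ⟨c, hc⟩ : ∃ c : Fin n → ℝ, ∀ i, c i = Segment.area (θ.angle (C.t i)) (E.disc i) /
      Segment.cuspCount (E.disc i) := ⟨_, fun _ => rfl⟩
    have hweight : θ.weight E = ∑ i, c i := Finset.sum_congr rfl fun i _ => (hc i).symm
    have hshift : ∑ i, c (i + 1) = ∑ i, c i := Equiv.sum_comp (Equiv.addRight (1 : Fin n)) c
    have hc0 : ∀ i, 0 ≤ c i := fun i => by
      rw [hc]
      exact θ.area_div_nonneg _ (E.valid i) (E.admissible i)
    have hcases : ∀ i, E.rest i = [.cusp (w i) (C.g i) (C.f i)] ∨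
        θ.minAngle (C.t i) (C.v i) ≤ c i := fun i => by
      rw [hc, hw]
      exact θ.minAngle_le_area_div _ (E.valid i) (E.admissible i)
    have hstep : ∀ i, θ.pathLength (e i) ≤ (c i + c (i + 1)) / 2 := by
      intro i
      have h0 := hc0 i
      have h1 := hc0 (i + 1)
      rcases hcases i with h | h
      · rcases hcases (i + 1) with h' | h'
        · have ha := E.agree i
          rw [h, h'] at ha
          simp only [List.head?_cons, List.getLast?_singleton, Option.map_some, Segment.side,
            FaceSide.map, Option.some.injEq, FaceSide.vertex.injEq] at ha
          have hwb : w i = b i := (M.glue (C.t i) (C.g i)).injective (ha.trans (hb i))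
          have : e i = [] := by simp [e, cornerPath, hwb]
          rw [this]
          simp only [pathLength, List.map_nil, List.sum_nil]
          linarith
        · have := θ.pathLength_cornerPath_le_nbr ho (C.t_succ i) (C.v_succ i) (C.v_ne_g i) (hvw i)
            (hvb i) (hwg i) (hbg i)
          linarith
      · have := θ.pathLength_cornerPath_le ho (t := C.t i) (hvw i) (hvb i)
        linarith
    rw [pathLength_flatMap, ← Fin.sum_univ_def, hweight]
    refine (Finset.sum_le_sum fun i _ => hstep i).trans (le_of_eq ?_)
    rw [← Finset.sum_div, Finset.sum_add_distrib, hshift]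
    ring

lemma length_eq_pathLength_proj (γ : M.SimplicialCurve) :
    θ.length γ = θ.pathLength (proj ho γ.word) := by
  have : proj ho γ.word = γ.sides.flatMap fun d => proj ho d.path := by
    simp only [SimplicialCurve.word, proj, List.flatMap_assoc]
  rw [this, pathLength_flatMap, length]
  congr 1
  refine List.map_congr_left fun d _ => ?_
  rw [proj_path]
  refine (θ.pathLength_cornerPath ho _ _ ?_).symm
  have key : ∀ v f a b : Fin 4, [v, f, a].Nodup → [v, f, b].Nodup → a ≠ b → [v, a, b, f].Nodup := by
    decide
  exact key _ _ _ _ d.distinct_a d.distinct_b d.a_ne_b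

end AngleStructure

theorem proposition4p10 {T : Type*} [Fintype T] (M : IdealTriangulation T) (hM : M.Orientable)
    (θ : AngleStructure M) (s : M.ClosedCurve) (hs : s.Essential) :
    ∃ γ : M.SimplicialCurve, M.HasClass γ.word s ∧
      (∀ δ : M.SimplicialCurve, M.HasClass δ.word s → θ.length γ ≤ θ.length δ) ∧
      (θ.length γ : EReal) ≤ θ.combinatorialLength s := by
  obtain ⟨o, ho⟩ := hM
  replace ho : M.IsOrientation o := ho
  have hne : s.word ≠ [] := fun h => hs (h ▸ .refl _)
  have : Nonempty M.Node := by
    obtain ⟨l, -⟩ := List.exists_mem_of_ne_nil _ hne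
    exact ⟨M.src l⟩
  obtain ⟨x, hx⟩ := FaceGluing.isClosedWalk_iff.1 s.closed
  have hwalk := hx.proj ho
  have hback := FaceGluing.freelyHomotopic_realize_proj ho hx hne
  have hback' := FaceGluing.freelyHomotopic_realize_proj ho hx.reverse
    (fun h => hne (by simpa using congrArg FaceGluing.Word.reverse h))
  rw [FaceGluing.proj_reverse] at hback'
  obtain ⟨y, l, p, hp, hl, hmin⟩ := OrientedTriangulation.exists_shortest_closed
    (K := FaceGluing.boundarySurface ho) hwalk
    (fun h => hs (hback.symm.trans (FaceGluing.realize_homotopic ho h).freelyHomotopic))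
    (fun d => θ.edgeLength d.t d.v d.f) fun d => θ.edgeLength_pos _ _ _
  have hly : (FaceGluing.boundarySurface ho).IsWalk y y l :=
    hl.elim (fun h => h.isWalk.1) fun h => h.isWalk.1
  let γ : M.SimplicialCurve :=
    ⟨l.map (FaceGluing.toDirectedSide o), (FaceGluing.isPath_realize ho hly).isClosedWalk⟩
  have hlen : θ.length γ = (l.map fun d => θ.edgeLength d.t d.v d.f).sum := by
    simp [AngleStructure.length, γ, FaceGluing.toDirectedSide, Function.comp_def]
  have hclass : M.HasClass γ.word s := by
    rcases hl with hl | hl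
    · exact .inl ((FaceGluing.freelyHomotopic_realize ho hp hwalk (by simpa using hl)).trans hback)
    · exact .inr ((FaceGluing.freelyHomotopic_realize ho hp hwalk.inv (by simpa using hl)).trans
        hback')
  refine ⟨γ, hclass, fun δ hδ => ?_, ?_⟩
  · obtain ⟨k, hk, hconj⟩ := hδ.isConj ho
      ((FaceGluing.boundarySurface ho).treeHolonomy (FaceGluing.projNode ho x))
    obtain ⟨z, hz⟩ := FaceGluing.isClosedWalk_iff.1 δ.closed
    rw [hlen, θ.length_eq_pathLength_proj ho]
    exact hmin _ _ (hz.proj ho) k hk hconj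
  · refine le_iInf fun n => le_iInf fun hn => le_iInf fun C => le_iInf fun hC => le_iInf fun E => ?_
    obtain ⟨k, hk, hconj⟩ := hC.isConj ho
      ((FaceGluing.boundarySurface ho).treeHolonomy (FaceGluing.projNode ho x))
    obtain ⟨q, m, hm, hconj', hle⟩ := θ.exists_walk_le_weight ho
      ((FaceGluing.boundarySurface ho).treeHolonomy (FaceGluing.projNode ho x)) E
    rw [EReal.coe_le_coe_iff, hlen]
    exact (hmin _ _ hm k hk (hconj.trans hconj')).trans hle
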